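/- Let $1\le m\le n$ be integers. Let $\mathbb S(2n)$ be the space of real symmetric $2n\times 2n$ matrices with inner product $\langle X,Y\rangle=\operatorname{tr}(XY)$, $\mathbb P(2n)\subset\mathbb S(2n)$ the set of positive definite matrices, and $J=\begin{pmatrix}0&I_n\\-I_n&0\end{pmatrix}$. A real $2n\times 2n$ matrix $M$ is symplectic if $M^TJM=J$. For $A\in\mathbb P(2n)$ let $d_1(A)\le\dots\le d_n(A)$ be its symplectic eigenvalues, i.e. the positive numbers, determined by $A$, for which there is (by Williamson's theorem) a symplectic matrix $M$ with $$M^TAM=\begin{pmatrix}D&0\\0&D\end{pmatrix},\qquad D=\operatorname{diag}(d_1(A),\dots,d_n(A));\qquad(*)$$ let $Sp(2n,2n,A)$ be the set of all symplectic $M$ satisfying $(*)$. Define $\sigma_m:\mathbb S(2n)\to(-\infty,\infty]$ by $\sigma_m(P)=-2\sum_{j=1}^m d_j(P)$ for $P\in\mathbb P(2n)$ and $\sigma_m(P)=\infty$ otherwise. For $A\in\mathbb P(2n)$ the Fenchel subdifferential of $\sigma_m$ at $A$ is $$\partial\sigma_m(A)=\{X\in\mathbb S(2n):\langle X,H-A\rangle\le\sigma_m(H)-\sigma_m(A)\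 \text{ for all } H\in\mathbb S(2n)\}.$$ Let $r_m=\#\{j:d_j(A)=d_m(A)\}$ and $i_m=\#\{j\le m:d_j(A)=d_m(A)\}$, and let $\Delta_m(A)$ be the set of all real $2n\times 2m$ matrices $$\begin{pmatrix}P&Q\\-Q&P\end{pmatrix},\qquad P=\begin{pmatrix}I&0\\0&U\\0&0\end{pmatrix},\quad Q=\begin{pmatrix}0&0\\0&V\\0&0\end{pmatrix}\in\mathbb R^{n\times m},$$ where $I$ is the identity matrix of size $m-i_m$ (and the zero block above $V$ on the diagonal of $Q$ has the same size), and $U,V$ are real $r_m\times i_m$ matrices such that the columns of $U+\sqrt{-1}\,V$ are orthonormal in $\mathbb C^{r_m}$. Then $\sigma_m$ is convex on $\mathbb S(2n)$, and for every $A\in\mathbb P(2n)$ and every $M\in Sp(2n,2n,A)$, $$\partial\sigma_m(A)=\operatorname{conv}\{-MHH^TM^T:H\in\Delta_m(A)\},$$ where $\operatorname{conv}$ denotes the closed convex hull in $\mathbb S(2n)$. -/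

import Mathlib

open scoped Matrix

namespace SympSub

/-- The space `𝕊(ι)` of real symmetric matrices, with the topology induced by the space of
all matrices. -/
def SymMat (ι : Type*) : Submodule ℝ (Matrix ι ι ℝ) where
  carrier := {A | A.IsSymm}
  add_mem' hA hB := Matrix.IsSymm.add hA hB
  zero_mem' := Matrix.isSymm_zero
  smul_mem' c _ hA := Matrix.IsSymm.smul hA c

/-- The usual inner product `⟨X, Y⟩ = tr (X Y)` of symmetric matrices. -/
def trInner {ι : Type*} [Fintype ι] (X Y : SymMat ι) : ℝ :=
  Matrix.trace ((X : Matrix ι ι ℝ) * (Y : Matrix ι ι ℝ))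

/-- The Fenchel subdifferential of an extended real valued function at a point `A`
at which it is finite. -/
def fenchelSubdifferential {ι : Type*} [Fintype ι] (f : SymMat ι → EReal) (A : SymMat ι) :
    Set (SymMat ι) :=
  {X | ∀ H : SymMat ι, (trInner X (H - A) : EReal) ≤ f H - f A}

/-- Convexity of a function with values in `(-∞, ∞]` (in `EReal`, `0 * ⊤ = 0`). -/
def IsConvexExt {E : Type*} [AddCommGroup E] [Module ℝ E] (f : E → EReal) : Prop :=
  (∀ x, f x ≠ ⊥) ∧
    ∀ (x y : E) (a b : ℝ), 0 ≤ a → 0 ≤ b → a + b = 1 →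
      f (a • x + b • y) ≤ (a : EReal) * f x + (b : EReal) * f y

/-- `M` is symplectic and `Mᵀ A M = diag(D, D)`, where `D` is the diagonal matrix with positive
diagonal entries `d 0 ≤ d 1 ≤ ⋯`. (Replacing `J` by `-J` does not change the symplectic group.) -/
structure IsWilliamsonForm {n : ℕ} (A : Matrix (Fin n ⊕ Fin n) (Fin n ⊕ Fin n) ℝ)
    (d : Fin n → ℝ) (M : Matrix (Fin n ⊕ Fin n) (Fin n ⊕ Fin n) ℝ) : Prop where
  symplectic : M ∈ Matrix.symplecticGroup (Fin n) ℝ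
  pos : ∀ j, 0 < d j
  mono : Monotone d
  eq : Mᵀ * A * M = Matrix.fromBlocks (Matrix.diagonal d) 0 0 (Matrix.diagonal d)

open Classical in
/-- The symplectic eigenvalues `d₁(A) ≤ ⋯ ≤ dₙ(A)` of a real positive definite matrix, indexed from
`0`: the diagonal entries of `D` in Williamson's theorem (which says that they exist; they are
determined by `A`). The value is irrelevant for matrices which have no Williamson form. -/
noncomputable def sympEig {n : ℕ} (A : Matrix (Fin n ⊕ Fin n) (Fin n ⊕ Fin n) ℝ) : Fin n → ℝ :=
  if h : ∃ d : Fin n → ℝ, ∃ M, IsWilliamsonForm A d M then h.choose else 0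

/-- The set `Sp(2n, 2n, A)` of the symplectic matrices `M = [u₁, …, uₙ, v₁, …, vₙ]` whose columns
are pairs of symplectic eigenvectors: `A uⱼ = dⱼ(A) J vⱼ` and `A vⱼ = - dⱼ(A) J uⱼ` with
`J = [0, I; -I, 0]`. Equivalently, `Mᵀ A M = diag(D, D)` with `D = diag(d₁(A), …, dₙ(A))`. -/
def SpEigenbasis {n : ℕ} (A : Matrix (Fin n ⊕ Fin n) (Fin n ⊕ Fin n) ℝ) :
    Set (Matrix (Fin n ⊕ Fin n) (Fin n ⊕ Fin n) ℝ) :=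
  {M | IsWilliamsonForm A (sympEig A) M}

open Classical in
/-- `σₘ(P) = -2 (d₁(P) + ⋯ + dₘ(P))` for positive definite `P`, and `+∞` otherwise. -/
noncomputable def sigma {n : ℕ} (m : ℕ) (P : SymMat (Fin n ⊕ Fin n)) : EReal :=
  if (P : Matrix (Fin n ⊕ Fin n) (Fin n ⊕ Fin n) ℝ).PosDef then
    ((-2 * ∑ j : Fin n with j.val < m,
      sympEig (P : Matrix (Fin n ⊕ Fin n) (Fin n ⊕ Fin n) ℝ) j : ℝ) : EReal)
  else ⊤

open Classical in
/-- The number of indices `j` with `d j = d k`. -/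
noncomputable def mult {n : ℕ} (d : Fin n → ℝ) (k : Fin n) : ℕ :=
  (Finset.univ.filter fun j : Fin n => d j = d k).card

open Classical in
/-- The number of indices `j ≤ k` with `d j = d k`. -/
noncomputable def lowerMult {n : ℕ} (d : Fin n → ℝ) (k : Fin n) : ℕ :=
  (Finset.univ.filter fun j : Fin n => j ≤ k ∧ d j = d k).card

/-- The `n × m` matrix `[T, 0; 0, W; 0, 0]` with blocks `T` of size `(m - i) × (m - i)` and
`W` of size `r × i`. -/
def columnBlocks (n m r i : ℕ) (T : Matrix (Fin (m - i)) (Fin (m - i)) ℝ)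
    (W : Matrix (Fin r) (Fin i) ℝ) : Matrix (Fin n) (Fin m) ℝ :=
  Matrix.of fun k l =>
    if h : k.val < m - i ∧ l.val < m - i then T ⟨k.val, h.1⟩ ⟨l.val, h.2⟩
    else if h : (m - i ≤ k.val ∧ k.val < m - i + r) ∧ m - i ≤ l.val then
      W ⟨k.val - (m - i), by omega⟩ ⟨l.val - (m - i), by omega⟩
    else 0

/-- The columns of `U + √-1 V` are orthonormal with respect to the standard Hermitian inner
product. -/
def OrthonormalColumns {r i : ℕ} (U V : Matrix (Fin r) (Fin i) ℝ) : Prop :=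
  Orthonormal ℂ fun l : Fin i =>
    (WithLp.toLp 2 fun k : Fin r => (U k l : ℂ) + Complex.I * (V k l : ℂ) :
      EuclideanSpace ℂ (Fin r))

/-- The set `Δₘ(A)` of `2n × 2m` matrices `[P, Q; -Q, P]` with `P = [I, 0; 0, U; 0, 0]` and
`Q = [0, 0; 0, V; 0, 0]`, where `I` is the identity matrix of size `m - iₘ` and
`U, V` are `rₘ × iₘ` real matrices such that the columns of `U + √-1 V` are orthonormal. -/
def Delta {n : ℕ} (m : ℕ) (hm : 1 ≤ m) (hmn : m ≤ n)
    (A : Matrix (Fin n ⊕ Fin n) (Fin n ⊕ Fin n) ℝ) :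
    Set (Matrix (Fin n ⊕ Fin n) (Fin m ⊕ Fin m) ℝ) :=
  let k : Fin n := ⟨m - 1, by omega⟩
  let r := mult (sympEig A) k
  let i := lowerMult (sympEig A) k
  {H | ∃ U V : Matrix (Fin r) (Fin i) ℝ, OrthonormalColumns U V ∧
    H = Matrix.fromBlocks (columnBlocks n m r i 1 U) (columnBlocks n m r i 0 V)
      (-columnBlocks n m r i 0 V) (columnBlocks n m r i 1 U)}

end SympSub

namespace SympSub

/-! Call a real `2n × 2m` matrix `S` with `SᵀJS = J` a symplectic frame. The engine is the
symplectic trace minimum principle: `2(d₁(A) + ⋯ + dₘ(A))` is the minimum of `tr(SᵀAS)` over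
symplectic frames. Hence `σₘ` is, on positive definite matrices, a supremum of the linear
functionals `A ↦ -tr(SᵀAS) = ⟨-SSᵀ, A⟩`, which gives convexity, and `-SSᵀ` is a subgradient at `A`
whenever `S` is a minimizer for `A`.

The minimum principle is reduced by Williamson's theorem (`exists_isWilliamsonForm`) to `A = diag(D,
D)`. There `S` is split into its complex linear part `α` and antilinear part `β`, with `αᵀα = 1 +
βᵀβ`; `ααᵀ` dominates a projection of rank `2m`, and a rearrangement argument (`bathtub`) bounds the
weighted trace. Equality (`IsSymplecticFrame.le_trace_doubleDiag`) forces `β = 0`, so that `S` is a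
complex isometry, and fixes its row norms outside the level of `dₘ`. Up to a unitary factor on the
right, which `SSᵀ` does not see, such isometries are exactly the elements of `Delta`
(`mul_mem_Delta_of_trace_eq`, `trace_eq_of_mem_Delta`).

For the hard inclusion, a subgradient `X` outside the closed convex hull would be strictly separated
from it by some `Y ↦ tr(YB)`. Minimizers for `A + tB`, by compactness as `t → 0`, produce a
minimizer `S` for `A` with `⟨X, B⟩ ≤ ⟨-SSᵀ, B⟩` (`exists_frame_trInner_le`), a contradiction. -/

/-! ### Normal form of skew maps and Williamson's theorem. -/

theorem exists_orthonormal_pairs_of_skew {E : Type*} [NormedAddCommGroup E]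
    [InnerProductSpace ℝ E] [FiniteDimensional ℝ E] {n : ℕ} (hE : Module.finrank ℝ E = 2 * n)
    (T : E →ₗ[ℝ] E) (hT : ∀ x y, inner ℝ (T x) y = -inner ℝ x (T y))
    (hinj : Function.Injective T) :
    ∀ k ≤ n, ∃ (e : Fin k → ℝ) (u v : Fin k → E), (∀ j, 0 < e j) ∧
      Orthonormal ℝ (Sum.elim u v) ∧ (∀ j, T (u j) = e j • v j) ∧
      (∀ j, T (v j) = -(e j • u j)) := by
  intro k
  induction k with
  | zero =>
    intro _
    refine ⟨Fin.elim0, Fin.elim0, Fin.elim0, fun j => j.elim0, ?_, fun j => j.elim0,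
      fun j => j.elim0⟩
    exact ⟨fun i => by rcases i with i | i <;> exact i.elim0,
      fun i => by rcases i with i | i <;> exact i.elim0⟩
  | succ k ih =>
    intro hk
    obtain ⟨e, u, v, he, ho, hu, hv⟩ := ih (by omega)
    set w : Fin k ⊕ Fin k → E := Sum.elim u v with hw
    set K : Submodule ℝ E := Submodule.span ℝ (Set.range w) with hK
    have hW : ∀ x, x ∈ Kᗮ ↔ ∀ i, inner ℝ (w i) x = 0 := by
      intro x
      rw [hK, ← Submodule.span_singleton_le_iff_mem, ← Submodule.isOrtho_iff_le, Submodule.isOrtho_comm,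
        Submodule.isOrtho_span]
      simp only [Set.mem_range, forall_exists_index, forall_apply_eq_imp_iff, Set.mem_singleton_iff,
        forall_eq]
    have hTW : ∀ x ∈ Kᗮ, T x ∈ Kᗮ := by
      intro x hx
      rw [hW] at hx ⊢
      intro i
      have h1 : inner ℝ (w i) (T x) = -inner ℝ (T (w i)) x := by rw [hT]; simp
      rw [h1]
      rcases i with i | i
      · have := hx (Sum.inr i)
        simp only [hw, Sum.elim_inl, Sum.elim_inr] at this ⊢
        rw [hu, inner_smul_left, this]; simp
      · have := hx (Sum.inl i)
        simp only [hw, Sum.elim_inl, Sum.elim_inr] at this ⊢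
        rw [hv, inner_neg_left, inner_smul_left, this]; simp
    have hdim : 0 < Module.finrank ℝ Kᗮ := by
      have h1 := K.finrank_add_finrank_orthogonal
      have h2 : Module.finrank ℝ K ≤ 2 * k := by
        have := finrank_range_le_card (R := ℝ) w
        simp only [Fintype.card_sum, Fintype.card_fin] at this
        rw [hK]
        change Module.finrank ℝ (Submodule.span ℝ (Set.range w)) ≤ _ at this
        omega
      omega
    -- The square of a skew map is symmetric, so the spectral theorem on `Kᗮ` yields a unit
    -- eigenvector `x`; then `x` and the normalized `T x` span a plane invariant under `T`, which is
    -- the new pair.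
    have hSsymm : (-(T ∘ₗ T)).IsSymmetric := by
      intro x y
      simp [hT]
    have hSW : ∀ x ∈ Kᗮ, (-(T ∘ₗ T)) x ∈ Kᗮ := by
      intro x hx
      simpa using hTW _ (hTW _ hx)
    have hR := hSsymm.restrict_invariant hSW
    set x : Kᗮ := hR.eigenvectorBasis rfl ⟨0, hdim⟩ with hx
    have hx1 : ‖(x : E)‖ = 1 := (hR.eigenvectorBasis rfl).orthonormal.1 ⟨0, hdim⟩
    have hx2 := hR.apply_eigenvectorBasis rfl ⟨0, hdim⟩
    rw [← hx] at hx2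
    set μ := hR.eigenvalues rfl ⟨0, hdim⟩
    have hTT : T (T x) = -(μ • (x : E)) := by
      have := congrArg Subtype.val hx2
      simp only [LinearMap.coe_restrict_apply] at this
      simp at this
      rw [← this, neg_neg]
    have hxx : inner ℝ (x : E) (x : E) = 1 := by rw [real_inner_self_eq_norm_sq, hx1]; norm_num
    have hμ : μ = ‖T x‖ ^ 2 := by
      rw [← real_inner_self_eq_norm_sq, hT, hTT, inner_neg_right, inner_smul_right, hxx]; simp
    have hx0 : (x : E) ≠ 0 := by rw [← norm_ne_zero_iff, hx1]; norm_num
    have hTx : T x ≠ 0 := fun h => hx0 (hinj (by rw [h, map_zero]))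
    set f := ‖T x‖ with hf
    have hfpos : 0 < f := norm_pos_iff.2 hTx
    set y : E := f⁻¹ • T x with hy
    have hTxy : T x = f • y := by rw [hy, smul_smul, mul_inv_cancel₀ hfpos.ne', one_smul]
    have hTy : T y = -(f • (x : E)) := by
      rw [hy, map_smul, hTT, hμ, smul_neg, smul_smul]
      congr 2
      field_simp
    have hyW : y ∈ Kᗮ := Kᗮ.smul_mem _ (hTW _ x.2)
    have hyy : inner ℝ y y = 1 := by
      rw [hy, inner_smul_left, inner_smul_right, real_inner_self_eq_norm_sq, ← hf]
      simp; field_simp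
    have hxy : inner ℝ (x : E) y = 0 := by
      have h1 := hT x x
      rw [real_inner_comm] at h1
      rw [hy, inner_smul_right]
      have : inner ℝ (x : E) (T x) = 0 := by linarith
      rw [this, mul_zero]
    have hxw := (hW x).1 x.2
    have hyw := (hW y).1 hyW
    have hxw' : ∀ i, inner ℝ (x : E) (w i) = 0 := fun i => by rw [real_inner_comm]; exact hxw i
    have hyw' : ∀ i, inner ℝ y (w i) = 0 := fun i => by rw [real_inner_comm]; exact hyw i
    have hyx : inner ℝ y (x : E) = 0 := by rw [real_inner_comm]; exact hxy
    refine ⟨Fin.cons f e, Fin.cons x u, Fin.cons y v, ?_, ?_, ?_, ?_⟩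
    · intro j
      refine Fin.cases ?_ (fun j => ?_) j <;> simp [hfpos, he]
    · rw [orthonormal_iff_ite] at ho ⊢
      rintro (i | i) (j | j) <;> refine Fin.cases ?_ (fun i => ?_) i <;>
        refine Fin.cases ?_ (fun j => ?_) j
      · simp [hx1]
      · simpa [Fin.succ_ne_zero, eq_comm, hw] using hxw' (Sum.inl j)
      · simpa [Fin.succ_ne_zero, hw] using hxw (Sum.inl i)
      · simpa [hw] using ho (Sum.inl i) (Sum.inl j)
      · simpa using hxy
      · simpa [hw] using hxw' (Sum.inr j)
      · simpa [hw] using hyw (Sum.inl i)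
      · simpa [hw] using ho (Sum.inl i) (Sum.inr j)
      · simpa using hyx
      · simpa [hw] using hyw' (Sum.inl j)
      · simpa [hw] using hxw (Sum.inr i)
      · simpa [hw] using ho (Sum.inr i) (Sum.inl j)
      · simpa using hyy
      · simpa [Fin.succ_ne_zero, eq_comm, hw] using hyw' (Sum.inr j)
      · simpa [Fin.succ_ne_zero, hw] using hyw (Sum.inr i)
      · simpa [hw] using ho (Sum.inr i) (Sum.inr j)
    · intro j
      refine Fin.cases ?_ (fun j => ?_) j
      · simpa using hTxy
      · simpa using hu j
    · intro j
      refine Fin.cases ?_ (fun j => ?_) j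
      · simpa using hTy
      · simpa using hv j

open scoped MatrixOrder in
theorem exists_transpose_mul_self_of_posDef {ι : Type*} [Fintype ι] [DecidableEq ι]
    {A : Matrix ι ι ℝ} (hA : A.PosDef) : ∃ C : Matrix ι ι ℝ, IsUnit C.det ∧ A = Cᵀ * C := by
  obtain ⟨C, rfl⟩ := CStarAlgebra.nonneg_iff_eq_star_mul_self.mp hA.posSemidef.nonneg
  refine ⟨C, ?_, rfl⟩
  have h := (Matrix.isUnit_iff_isUnit_det _).1 hA.isUnit
  rw [Matrix.det_mul] at h
  exact isUnit_of_mul_isUnit_right h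

/-- The real normal form of an invertible skew-symmetric matrix. -/
theorem exists_orthogonal_of_skew {n : ℕ} (T : Matrix (Fin n ⊕ Fin n) (Fin n ⊕ Fin n) ℝ)
    (hT : Tᵀ = -T) (hdet : IsUnit T.det) :
    ∃ (e : Fin n → ℝ) (O : Matrix (Fin n ⊕ Fin n) (Fin n ⊕ Fin n) ℝ), (∀ j, 0 < e j) ∧
      (Monotone fun j => (e j)⁻¹) ∧ Oᵀ * O = 1 ∧ Oᵀ * T * O =
        Matrix.fromBlocks 0 (-Matrix.diagonal e) (Matrix.diagonal e) 0 := by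
  have hin : ∀ x y : EuclideanSpace ℝ (Fin n ⊕ Fin n),
      inner ℝ x y = x.ofLp ⬝ᵥ y.ofLp := fun x y => by
    rw [EuclideanSpace.inner_eq_star_dotProduct, dotProduct_comm]; simp
  have hap : ∀ x : EuclideanSpace ℝ (Fin n ⊕ Fin n),
      (Matrix.toEuclideanLin T x).ofLp = T *ᵥ x.ofLp := fun x => rfl
  obtain ⟨e', u', v', he', ho', hu', hv'⟩ := exists_orthonormal_pairs_of_skew (n := n)
    (E := EuclideanSpace ℝ (Fin n ⊕ Fin n)) (by simp; omega) (Matrix.toEuclideanLin T)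
    (fun x y => by
      rw [hin, hin, hap, hap,
        Matrix.dotProduct_mulVec, ← Matrix.mulVec_transpose, hT, Matrix.neg_mulVec, neg_dotProduct,
        neg_neg])
    (fun x y hxy => by
      have h := congrArg WithLp.ofLp hxy
      simp only [hap] at h
      have h2 := Matrix.mulVec_injective_of_isUnit ((Matrix.isUnit_iff_isUnit_det T).2 hdet) h
      exact WithLp.ofLp_injective _ h2) n le_rfl
  -- The reciprocals are sorted because they become the symplectic eigenvalues.
  let σ : Equiv.Perm (Fin n) := Tuple.sort fun j => (e' j)⁻¹
  obtain ⟨e, hee⟩ : ∃ e, e = e' ∘ σ := ⟨_, rfl⟩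
  obtain ⟨u, huu⟩ : ∃ u, u = u' ∘ σ := ⟨_, rfl⟩
  obtain ⟨v, hvv⟩ : ∃ v, v = v' ∘ σ := ⟨_, rfl⟩
  have he : ∀ j, 0 < e j := fun j => by rw [hee]; exact he' _
  have hmono : Monotone fun j => (e j)⁻¹ := by
    rw [hee]; exact Tuple.monotone_sort fun j => (e' j)⁻¹
  have hu : ∀ j, Matrix.toEuclideanLin T (u j) = e j • v j := fun j => by
    rw [hee, huu, hvv]; exact hu' _
  have hv : ∀ j, Matrix.toEuclideanLin T (v j) = -(e j • u j) := fun j => by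
    rw [hee, huu, hvv]; exact hv' _
  have ho : Orthonormal ℝ (Sum.elim u v) := by
    have := ho'.comp (Sum.map σ σ) (σ.injective.sumMap σ.injective)
    rwa [Sum.elim_comp_map, ← huu, ← hvv] at this
  let w : Fin n ⊕ Fin n → EuclideanSpace ℝ (Fin n ⊕ Fin n) := Sum.elim u v
  let O : Matrix (Fin n ⊕ Fin n) (Fin n ⊕ Fin n) ℝ := Matrix.of fun k i => w i k
  have hO : ∀ i j, (Oᵀ * O) i j = inner ℝ (w i) (w j) := by
    intro i j
    rw [hin]; rfl
  have hOT : ∀ i j, (Oᵀ * T * O) i j = inner ℝ (w i) (Matrix.toEuclideanLin T (w j)) := by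
    intro i j
    rw [hin, hap, Matrix.mul_assoc]; rfl
  rw [orthonormal_iff_ite] at ho
  refine ⟨e, O, he, hmono, ?_, ?_⟩
  · ext i j
    rw [hO, Matrix.one_apply]
    exact ho i j
  · ext i j
    rw [hOT]
    rcases i with i | i <;> rcases j with j | j
    · have := ho (Sum.inl i) (Sum.inr j)
      simp at this
      simp [w, hu, inner_smul_right, this]
    · have := ho (Sum.inl i) (Sum.inl j)
      simp at this
      simp [w, hv, inner_smul_right, this, Matrix.diagonal_apply]
      split_ifs with h <;> simp [h]
    · have := ho (Sum.inr i) (Sum.inr j)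
      simp at this
      simp [w, hu, inner_smul_right, this, Matrix.diagonal_apply]
      split_ifs with h <;> simp [h]
    · have := ho (Sum.inr i) (Sum.inl j)
      simp at this
      simp [w, hv, inner_smul_right, this]

/-- Williamson's theorem. -/
theorem exists_isWilliamsonForm {n : ℕ} {A : Matrix (Fin n ⊕ Fin n) (Fin n ⊕ Fin n) ℝ}
    (hA : A.PosDef) : ∃ d M, IsWilliamsonForm A d M := by
  obtain ⟨C, hC, rfl⟩ := exists_transpose_mul_self_of_posDef hA
  -- With `A = CᵀC` and `M = C⁻¹OD`, where `D` has the entries `e⁻¹ᐟ²`, one gets `MᵀAM = D²` by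
  -- orthogonality of `O`, while `MᵀJM` is the skew normal form of `C⁻ᵀJC⁻¹` rescaled by `D` to `J`.
  obtain ⟨e, O, he, hmono, hO, hTO⟩ := exists_orthogonal_of_skew
    ((C⁻¹)ᵀ * Matrix.J (Fin n) ℝ * C⁻¹)
    (by simp [Matrix.transpose_mul, Matrix.J_transpose, Matrix.mul_assoc])
    (by
      rw [Matrix.det_mul, Matrix.det_mul, Matrix.det_transpose]
      have h1 : IsUnit (C⁻¹).det := (Matrix.isUnit_nonsing_inv_det C hC)
      exact (h1.mul (Matrix.isUnit_det_J _ _)).mul h1)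
  let s : Fin n → ℝ := fun j => (√(e j))⁻¹
  have hs : ∀ j, s j * s j = (e j)⁻¹ := fun j => by
    simp only [s]
    rw [← mul_inv, Real.mul_self_sqrt (he j).le]
  let D : Matrix (Fin n ⊕ Fin n) (Fin n ⊕ Fin n) ℝ :=
    Matrix.fromBlocks (Matrix.diagonal s) 0 0 (Matrix.diagonal s)
  have hD : Dᵀ = D := by simp [D]
  refine ⟨fun j => (e j)⁻¹, C⁻¹ * O * D, ?_, fun j => inv_pos.2 (he j), hmono, ?_⟩
  · rw [SymplecticGroup.mem_iff']
    have : (C⁻¹ * O * D)ᵀ * Matrix.J (Fin n) ℝ * (C⁻¹ * O * D) =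
        D * (Oᵀ * ((C⁻¹)ᵀ * Matrix.J (Fin n) ℝ * C⁻¹) * O) * D := by
      simp only [Matrix.transpose_mul, hD, Matrix.mul_assoc]
    rw [this, hTO]
    have h2 : ∀ j, s j * e j * s j = 1 := fun j => by
      rw [mul_right_comm, hs, inv_mul_cancel₀ (he j).ne']
    simp only [D, Matrix.J, Matrix.fromBlocks_multiply]
    simp only [Matrix.zero_mul, Matrix.mul_zero, Matrix.diagonal_mul_diagonal, add_zero, zero_add,
      Matrix.mul_neg, Matrix.neg_mul, h2, Matrix.diagonal_one, neg_zero]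
  · have : (C⁻¹ * O * D)ᵀ * (Cᵀ * C) * (C⁻¹ * O * D) =
        D * (Oᵀ * ((C * C⁻¹)ᵀ * (C * C⁻¹)) * O) * D := by
      simp only [Matrix.transpose_mul, hD, Matrix.mul_assoc]
    rw [this, Matrix.mul_nonsing_inv _ hC]
    simp only [Matrix.transpose_one, Matrix.mul_one, hO, D, Matrix.fromBlocks_multiply]
    simp [hs]

theorem exists_isWilliamsonForm_sympEig {n : ℕ}
    {A : Matrix (Fin n ⊕ Fin n) (Fin n ⊕ Fin n) ℝ} (hA : A.PosDef) :
    ∃ M, IsWilliamsonForm A (sympEig A) M := by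
  have h := exists_isWilliamsonForm hA
  rw [sympEig, dif_pos h]
  exact h.choose_spec

/-! ### Complex matrices as real matrices intertwining the structures `J`. -/

/-- The real matrix `[P, Q; -Q, P]` of the complex matrix `P + √-1 Q`. -/
def realify {ι κ : Type*} (W : Matrix ι κ ℂ) : Matrix (ι ⊕ ι) (κ ⊕ κ) ℝ :=
  Matrix.fromBlocks (W.map Complex.re) (W.map Complex.im) (-W.map Complex.im) (W.map Complex.re)

theorem realify_mul {ι κ τ : Type*} [Fintype κ] (V : Matrix ι κ ℂ) (W : Matrix κ τ ℂ) :
    realify (V * W) = realify V * realify W := by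
  rw [realify, realify, realify, Matrix.fromBlocks_multiply]
  congr 1 <;> ext i j <;>
    simp [Matrix.mul_apply, Finset.sum_add_distrib, sub_eq_add_neg, add_comm]

theorem realify_conjTranspose {ι κ : Type*} (W : Matrix ι κ ℂ) :
    realify Wᴴ = (realify W)ᵀ := by
  rw [realify, realify, Matrix.fromBlocks_transpose]
  congr 1
  ext i j
  simp

theorem realify_one {ι : Type*} [DecidableEq ι] : realify (1 : Matrix ι ι ℂ) = 1 := by
  rw [realify, ← Matrix.fromBlocks_one]
  congr 1 <;> ext i j <;> by_cases h : i = j <;> simp [h, Matrix.one_apply]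

theorem realify_injective {ι κ : Type*} :
    Function.Injective (realify : Matrix ι κ ℂ → Matrix (ι ⊕ ι) (κ ⊕ κ) ℝ) := by
  intro V W h
  obtain ⟨h1, h2, -, -⟩ := Matrix.fromBlocks_inj.1 h
  ext i j
  exact Complex.ext (congrFun (congrFun h1 i) j) (congrFun (congrFun h2 i) j)

theorem realify_mul_J {n m : ℕ} (W : Matrix (Fin n) (Fin m) ℂ) :
    realify W * Matrix.J (Fin m) ℝ = Matrix.J (Fin n) ℝ * realify W := by
  rw [realify, Matrix.J, Matrix.J, Matrix.fromBlocks_multiply, Matrix.fromBlocks_multiply]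
  simp

theorem exists_realify_eq {n m : ℕ} {S : Matrix (Fin n ⊕ Fin n) (Fin m ⊕ Fin m) ℝ}
    (h : S * Matrix.J (Fin m) ℝ = Matrix.J (Fin n) ℝ * S) : ∃ W, S = realify W := by
  obtain ⟨a, b, c, d, rfl⟩ : ∃ a b c d, S = Matrix.fromBlocks a b c d :=
    ⟨_, _, _, _, S.fromBlocks_toBlocks.symm⟩
  rw [Matrix.J, Matrix.J, Matrix.fromBlocks_multiply, Matrix.fromBlocks_multiply] at h
  obtain ⟨h1, h2, h3, h4⟩ := Matrix.fromBlocks_inj.1 h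
  simp at h1 h2
  refine ⟨Matrix.of fun i j => ⟨a i j, b i j⟩, ?_⟩
  rw [realify]
  congr 1
  · rw [← neg_eq_iff_eq_neg.2 h1]; rfl
  · rw [← h2]; rfl

/-! ### Symplectic frames and the minimum of the trace for a diagonal form. -/

/-- The columns of `S` form a symplectic family. -/
def IsSymplecticFrame {n m : ℕ} (S : Matrix (Fin n ⊕ Fin n) (Fin m ⊕ Fin m) ℝ) : Prop :=
  Sᵀ * Matrix.J (Fin n) ℝ * S = Matrix.J (Fin m) ℝ

theorem isSymplecticFrame_realify {n m : ℕ} {W : Matrix (Fin n) (Fin m) ℂ} (hW : Wᴴ * W = 1) :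
    IsSymplecticFrame (realify W) := by
  rw [IsSymplecticFrame, Matrix.mul_assoc, ← realify_mul_J, ← Matrix.mul_assoc,
    ← realify_conjTranspose, ← realify_mul, hW, realify_one, Matrix.one_mul]

theorem IsSymplecticFrame.mul_left {n m : ℕ} {S : Matrix (Fin n ⊕ Fin n) (Fin m ⊕ Fin m) ℝ}
    (hS : IsSymplecticFrame S) {M : Matrix (Fin n ⊕ Fin n) (Fin n ⊕ Fin n) ℝ}
    (hM : M ∈ Matrix.symplecticGroup (Fin n) ℝ) : IsSymplecticFrame (M * S) := by
  rw [SymplecticGroup.mem_iff'] at hM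
  have : (M * S)ᵀ * Matrix.J (Fin n) ℝ * (M * S) = Sᵀ * (Mᵀ * Matrix.J (Fin n) ℝ * M) * S := by
    simp only [Matrix.transpose_mul, Matrix.mul_assoc]
  rw [IsSymplecticFrame, this, hM, hS]

/-- The doubled diagonal matrix `diag(D, D)`. -/
def doubleDiag {n : ℕ} (d : Fin n → ℝ) : Matrix (Fin n ⊕ Fin n) (Fin n ⊕ Fin n) ℝ :=
  Matrix.diagonal (Sum.elim d d)

theorem fromBlocks_eq_doubleDiag {n : ℕ} (d : Fin n → ℝ) :
    Matrix.fromBlocks (Matrix.diagonal d) 0 0 (Matrix.diagonal d) = doubleDiag d :=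
  Matrix.fromBlocks_diagonal d d

theorem J_mul_doubleDiag_mul_J {n : ℕ} (d : Fin n → ℝ) :
    Matrix.J (Fin n) ℝ * doubleDiag d * Matrix.J (Fin n) ℝ = -doubleDiag d := by
  rw [← fromBlocks_eq_doubleDiag, Matrix.J, Matrix.fromBlocks_multiply, Matrix.fromBlocks_multiply,
    Matrix.fromBlocks_neg]
  simp

theorem trace_transpose_mul_diagonal_mul {ι κ : Type*} [Fintype ι] [Fintype κ] [DecidableEq ι]
    (d : ι → ℝ) (S : Matrix ι κ ℝ) :
    (Sᵀ * Matrix.diagonal d * S).trace = ∑ k, d k * (S * Sᵀ) k k := by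
  rw [Matrix.trace_mul_comm, ← Matrix.mul_assoc, Matrix.trace]
  simp [Matrix.mul_diagonal, mul_comm]

/-- The splitting of a symplectic frame into its parts which commute and anticommute with `J`. -/
theorem IsSymplecticFrame.exists_decomposition {n m : ℕ}
    {S : Matrix (Fin n ⊕ Fin n) (Fin m ⊕ Fin m) ℝ} (hS : IsSymplecticFrame S) :
    ∃ α β : Matrix (Fin n ⊕ Fin n) (Fin m ⊕ Fin m) ℝ, S = α + β ∧
      α * Matrix.J (Fin m) ℝ = Matrix.J (Fin n) ℝ * α ∧ αᵀ * α = 1 + βᵀ * β ∧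
      ∀ d : Fin n → ℝ, (Sᵀ * doubleDiag d * S).trace =
        (αᵀ * doubleDiag d * α).trace + (βᵀ * doubleDiag d * β).trace := by
  have hJm := Matrix.J_squared (Fin m) ℝ
  have hJn := Matrix.J_squared (Fin n) ℝ
  have htm := Matrix.J_transpose (Fin m) ℝ
  have htn := Matrix.J_transpose (Fin n) ℝ
  set Jm := Matrix.J (Fin m) ℝ
  set Jn := Matrix.J (Fin n) ℝ
  rw [IsSymplecticFrame] at hS
  -- `S ↦ JSJ` is `-1` on matrices commuting with `J` and `+1` on those anticommuting, so `(S -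
  -- T)/2` and `(S + T)/2` are the two parts.
  obtain ⟨T, hT⟩ : ∃ T, T = Jn * S * Jm := ⟨_, rfl⟩
  have hTt : Tᵀ = Jm * Sᵀ * Jn := by
    rw [hT]; simp [Matrix.transpose_mul, htm, htn, Matrix.mul_assoc]
  have hST : Sᵀ * T = -1 := by
    rw [hT, ← Matrix.mul_assoc, ← Matrix.mul_assoc, hS, hJm]
  have hTS : Tᵀ * S = -1 := by
    rw [hTt, Matrix.mul_assoc, Matrix.mul_assoc, ← Matrix.mul_assoc Sᵀ, hS, hJm]
  refine ⟨(2⁻¹ : ℝ) • (S - T), (2⁻¹ : ℝ) • (S + T), ?_, ?_, ?_, fun d => ?_⟩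
  · ext i j
    simp; ring
  · have h1 : T * Jm = -(Jn * S) := by
      rw [hT, Matrix.mul_assoc, hJm]; simp
    have h2 : Jn * T = -(S * Jm) := by
      rw [hT, ← Matrix.mul_assoc, ← Matrix.mul_assoc, hJn]; simp
    rw [Matrix.smul_mul, Matrix.mul_smul, Matrix.sub_mul, Matrix.mul_sub, h1, h2]
    congr 1
    abel
  · have h1 : (S - T)ᵀ * (S - T) = (S + T)ᵀ * (S + T) + (4 : ℝ) • 1 := by
      simp only [Matrix.transpose_sub, Matrix.transpose_add, Matrix.sub_mul, Matrix.mul_sub,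
        Matrix.add_mul, Matrix.mul_add, hST, hTS]
      ext i j
      simp; ring
    rw [Matrix.transpose_smul, Matrix.transpose_smul, Matrix.smul_mul, Matrix.mul_smul,
      Matrix.smul_mul, Matrix.mul_smul, smul_smul, smul_smul, h1, smul_add, smul_smul,
      show (2⁻¹ * 2⁻¹ * 4 : ℝ) = 1 by norm_num, one_smul, add_comm]
  -- As `S` and `T` give the same trace, the cross terms cancel in the sum over `(S - T)/2` and `(S
  -- + T)/2`.
  · have h1 : (Tᵀ * doubleDiag d * T).trace = (Sᵀ * doubleDiag d * S).trace := by
      have h2 : Tᵀ * doubleDiag d * T = Jm * (Sᵀ * (Jn * doubleDiag d * Jn) * S) * Jm := by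
        rw [hTt, hT]; simp only [Matrix.mul_assoc]
      rw [h2, J_mul_doubleDiag_mul_J, Matrix.trace_mul_comm, ← Matrix.mul_assoc, hJm]
      simp
    simp only [Matrix.transpose_smul, Matrix.smul_mul, Matrix.mul_smul, Matrix.transpose_sub,
      Matrix.transpose_add, Matrix.sub_mul, Matrix.mul_sub, Matrix.add_mul, Matrix.mul_add,
      Matrix.trace_smul, Matrix.trace_sub, Matrix.trace_add, h1, smul_eq_mul]
    ring

theorem diag_mul_transpose_nonneg {ι κ : Type*} [Fintype κ] (S : Matrix ι κ ℝ) (k : ι) :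
    0 ≤ (S * Sᵀ) k k := by
  rw [Matrix.mul_apply]
  exact Finset.sum_nonneg fun j _ => mul_self_nonneg _

/-- If `αᵀ α = 1 + βᵀ β`, then the orthogonal projection onto the column space of `α` is dominated
by `α αᵀ`. -/
theorem exists_projection_le {ι κ : Type*} [Fintype ι] [Fintype κ] [DecidableEq κ]
    (α β : Matrix ι κ ℝ) (h : αᵀ * α = 1 + βᵀ * β) :
    ∃ Q : Matrix ι ι ℝ, Q.trace = Fintype.card κ ∧ (∀ k, 0 ≤ Q k k) ∧ (∀ k, Q k k ≤ 1) ∧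
      (∀ k, Q k k ≤ (α * αᵀ) k k) ∧ (β = 0 → Q = α * αᵀ) := by
  have hG : (αᵀ * α).PosDef := by
    rw [h]
    exact Matrix.PosDef.one.add_posSemidef (Matrix.posSemidef_conjTranspose_mul_self β)
  have hu : IsUnit (αᵀ * α).det := (Matrix.isUnit_iff_isUnit_det _).1 hG.isUnit
  obtain ⟨G, hGe⟩ : ∃ G, G = αᵀ * α := ⟨_, rfl⟩
  rw [← hGe] at hu h
  have hGt : Gᵀ = G := by rw [hGe]; simp [Matrix.transpose_mul]
  have hit : (G⁻¹)ᵀ = G⁻¹ := by rw [Matrix.transpose_nonsing_inv, hGt]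
  -- `Q = Yαᵀ = αG⁻¹αᵀ` is the orthogonal projection onto the range of `α`. Since `G = 1 + βᵀβ`, the
  -- difference `ααᵀ - Q = Y(G² - G)Yᵀ` is the sum of squares written in `hQ2`.
  obtain ⟨Y, hY⟩ : ∃ Y, Y = α * G⁻¹ := ⟨_, rfl⟩
  have hYt : Yᵀ = G⁻¹ * αᵀ := by rw [hY, Matrix.transpose_mul, hit]
  have hYG : Y * G = α := by
    rw [hY, Matrix.mul_assoc, Matrix.nonsing_inv_mul _ hu, Matrix.mul_one]
  have hGY : G * Yᵀ = αᵀ := by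
    rw [hYt, ← Matrix.mul_assoc, Matrix.mul_nonsing_inv _ hu, Matrix.one_mul]
  have hQ1 : Y * αᵀ = Y * Yᵀ + (Y * βᵀ) * (Y * βᵀ)ᵀ := by
    rw [← hGY, h]
    simp only [Matrix.transpose_mul, Matrix.transpose_transpose, Matrix.add_mul, Matrix.mul_add,
      Matrix.one_mul, Matrix.mul_assoc]
  have hsymm : α * Yᵀ = Y * αᵀ := by rw [hYt, hY, Matrix.mul_assoc]
  have hQ2 : α * αᵀ = Y * αᵀ + (α - Y) * (α - Y)ᵀ + (Y * βᵀ) * (Y * βᵀ)ᵀ := by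
    have : (Y * βᵀ) * (Y * βᵀ)ᵀ = Y * αᵀ - Y * Yᵀ := by rw [hQ1]; abel
    rw [this, Matrix.transpose_sub, Matrix.sub_mul, Matrix.mul_sub, Matrix.mul_sub, hsymm]
    abel
  have hQt : (Y * αᵀ)ᵀ = Y * αᵀ := by
    rw [Matrix.transpose_mul, Matrix.transpose_transpose, hsymm]
  have hQQ : (Y * αᵀ) * (Y * αᵀ)ᵀ = Y * αᵀ := by
    rw [hQt, ← hsymm, Matrix.mul_assoc, ← Matrix.mul_assoc Yᵀ, hYt, Matrix.mul_assoc _ αᵀ α, ← hGe,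
      Matrix.nonsing_inv_mul _ hu, Matrix.one_mul]
  refine ⟨Y * αᵀ, ?_, fun k => ?_, fun k => ?_, fun k => ?_, fun hβ => ?_⟩
  · rw [Matrix.trace_mul_comm, hY, ← Matrix.mul_assoc, ← hGe, Matrix.mul_nonsing_inv _ hu,
      Matrix.trace_one]
  · rw [← hQQ]; exact diag_mul_transpose_nonneg _ _
  · have h1 : (Y * αᵀ) k k * (Y * αᵀ) k k ≤ (Y * αᵀ) k k := by
      conv_rhs => rw [← hQQ, Matrix.mul_apply]
      exact Finset.single_le_sum (f := fun j => (Y * αᵀ) k j * (Y * αᵀ)ᵀ j k)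
        (fun j _ => mul_self_nonneg _) (Finset.mem_univ k)
    nlinarith
  · conv_rhs => rw [hQ2]
    have h1 := diag_mul_transpose_nonneg (α - Y) k
    have h2 := diag_mul_transpose_nonneg (Y * βᵀ) k
    simp only [Matrix.add_apply]
    linarith
  · have : Y = α := by
      rw [← hYG, h, hβ]; simp
    rw [this]

/-- Subtracting `c` times the constraint `∑ p = m`, with `c` the `m`-th smallest value, turns the
difference of the two sums into `∑ (d k - c)(p k - 1_{k < m})`, whose terms are all nonnegative.
Equality kills each term, which determines `p k` wherever `d k ≠ c`. -/
theorem bathtub {n m : ℕ} (hm : 1 ≤ m) (hmn : m ≤ n) {d p : Fin n → ℝ} (hd : Monotone d)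
    (h0 : ∀ k, 0 ≤ p k) (h1 : ∀ k, p k ≤ 1) (hp : ∑ k, p k = m) :
    ∑ k : Fin n with k.val < m, d k ≤ ∑ k, d k * p k ∧
      (∑ k, d k * p k = ∑ k : Fin n with k.val < m, d k → ∀ k,
        d k ≠ d ⟨m - 1, by omega⟩ → p k = if k.val < m then 1 else 0) := by
  set c := d ⟨m - 1, by omega⟩ with hc
  have hcard : ∑ k : Fin n, (if k.val < m then (1 : ℝ) else 0) = m := by
    rw [Finset.sum_boole]
    norm_cast
    simp [Fin.card_filter_val_lt, hmn]
  have key : ∑ k, d k * p k - ∑ k : Fin n with k.val < m, d k =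
      ∑ k, (d k - c) * (p k - if k.val < m then 1 else 0) := by
    have : ∀ k : Fin n, (d k - c) * (p k - if k.val < m then 1 else 0) =
        d k * p k - (if k.val < m then d k else 0) - c * (p k - if k.val < m then 1 else 0) := by
      intro k; split_ifs <;> ring
    simp only [this, Finset.sum_sub_distrib, ← Finset.mul_sum, hp, hcard, Finset.sum_filter]
    ring
  have hterm : ∀ k, 0 ≤ (d k - c) * (p k - if k.val < m then 1 else 0) := by
    intro k
    split_ifs with h
    · have : d k ≤ c := hd (Fin.le_def.2 (by simp; omega))
      exact mul_nonneg_of_nonpos_of_nonpos (by linarith) (by linarith [h1 k])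
    · have : c ≤ d k := hd (Fin.le_def.2 (by simp; omega))
      exact mul_nonneg (by linarith) (by linarith [h0 k])
  refine ⟨by linarith [Finset.sum_nonneg fun k (_ : k ∈ Finset.univ) => hterm k], fun he k hk => ?_⟩
  have := (Finset.sum_eq_zero_iff_of_nonneg fun k _ => hterm k).1 (by linarith) k
    (Finset.mem_univ k)
  rcases mul_eq_zero.1 this with h | h
  · exact absurd (sub_eq_zero.1 h) hk
  · exact sub_eq_zero.1 h

/-- The trace minimum principle for `diag(D, D)` with the necessary conditions for equality;
`trace_realify_doubleDiag` shows that they also suffice. -/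
theorem IsSymplecticFrame.le_trace_doubleDiag {n m : ℕ} (hm : 1 ≤ m) (hmn : m ≤ n)
    {S : Matrix (Fin n ⊕ Fin n) (Fin m ⊕ Fin m) ℝ} (hS : IsSymplecticFrame S) {d : Fin n → ℝ}
    (hpos : ∀ j, 0 < d j) (hd : Monotone d) :
    2 * ∑ k : Fin n with k.val < m, d k ≤ (Sᵀ * doubleDiag d * S).trace ∧
      ((Sᵀ * doubleDiag d * S).trace = 2 * ∑ k : Fin n with k.val < m, d k →
        ∃ W : Matrix (Fin n) (Fin m) ℂ, S = realify W ∧ Wᴴ * W = 1 ∧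
          ∀ k, d k ≠ d ⟨m - 1, by omega⟩ →
            ∑ l, ‖W k l‖ ^ 2 = if k.val < m then 1 else 0) := by
  obtain ⟨α, β, rfl, hα, hαβ, htr⟩ := hS.exists_decomposition
  obtain ⟨Q, hQt, hQ0, hQ1, hQα, hQβ⟩ := exists_projection_le α β hαβ
  -- Each `d k` occurs twice in `diag(D, D)`, so the two diagonal entries of `Q` are averaged; `tr Q
  -- = 2m` gives total weight `m`.
  let p : Fin n → ℝ := fun k => (Q (Sum.inl k) (Sum.inl k) + Q (Sum.inr k) (Sum.inr k)) / 2
  have hp0 : ∀ k, 0 ≤ p k := fun k => by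
    have := hQ0 (Sum.inl k); have := hQ0 (Sum.inr k); simp only [p]; linarith
  have hp1 : ∀ k, p k ≤ 1 := fun k => by
    have := hQ1 (Sum.inl k); have := hQ1 (Sum.inr k); simp only [p]; linarith
  have hp : ∑ k, p k = m := by
    simp only [Matrix.trace, Matrix.diag, Fintype.sum_sum_type, Fintype.card_sum,
      Fintype.card_fin, Nat.cast_add] at hQt
    simp only [p, ← Finset.sum_div, Finset.sum_add_distrib, hQt]
    ring
  obtain ⟨hb, hbe⟩ := bathtub hm hmn hd hp0 hp1 hp
  have hdd : ∀ k : Fin n ⊕ Fin n, 0 < Sum.elim d d k := by rintro (k | k) <;> exact hpos k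
  have hsum : 2 * ∑ k, d k * p k = ∑ k, Sum.elim d d k * Q k k := by
    rw [Fintype.sum_sum_type, ← Finset.sum_add_distrib, Finset.mul_sum]
    refine Finset.sum_congr rfl fun k _ => ?_
    simp only [p, Sum.elim_inl, Sum.elim_inr]; ring
  have hαQ : ∑ k, Sum.elim d d k * Q k k ≤ (αᵀ * doubleDiag d * α).trace := by
    rw [doubleDiag, trace_transpose_mul_diagonal_mul]
    exact Finset.sum_le_sum fun k _ => mul_le_mul_of_nonneg_left (hQα k) (hdd k).le
  have hβ0 : ∀ k, 0 ≤ Sum.elim d d k * (β * βᵀ) k k := fun k =>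
    mul_nonneg (hdd k).le (diag_mul_transpose_nonneg _ _)
  have hβn : 0 ≤ (βᵀ * doubleDiag d * β).trace := by
    rw [doubleDiag, trace_transpose_mul_diagonal_mul]
    exact Finset.sum_nonneg fun k _ => hβ0 k
  rw [htr]
  refine ⟨by linarith, fun he => ?_⟩
  -- Equality leaves no room for the antilinear part; as `D` is positive, `β` vanishes, and then `Q
  -- = ααᵀ`, so the weights `p` are the squared row norms of `W`.
  have hβz : (βᵀ * doubleDiag d * β).trace = 0 := by linarith
  have hβ : β = 0 := by
    rw [doubleDiag, trace_transpose_mul_diagonal_mul,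
      Finset.sum_eq_zero_iff_of_nonneg fun k _ => hβ0 k] at hβz
    ext k l
    have h1 : (β * βᵀ) k k = 0 := by
      have := hβz k (Finset.mem_univ k)
      exact (mul_eq_zero.1 this).resolve_left (hdd k).ne'
    rw [Matrix.mul_apply] at h1
    simp only [Matrix.transpose_apply] at h1
    rw [Finset.sum_eq_zero_iff_of_nonneg fun j _ => mul_self_nonneg _] at h1
    exact mul_self_eq_zero.1 (h1 l (Finset.mem_univ l))
  have hQ := hQβ hβ
  obtain ⟨W, rfl⟩ := exists_realify_eq hα
  refine ⟨W, by rw [hβ, add_zero], ?_, fun k hk => ?_⟩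
  · apply realify_injective
    rw [realify_mul, realify_conjTranspose, hαβ, hβ, realify_one]
    simp
  · rw [← hbe (by linarith) k hk]
    simp only [p, hQ, Matrix.mul_apply, Fintype.sum_sum_type, realify, Matrix.transpose_apply,
      Matrix.fromBlocks_apply₁₁, Matrix.fromBlocks_apply₁₂, Matrix.fromBlocks_apply₂₁,
      Matrix.fromBlocks_apply₂₂, ← Finset.sum_add_distrib, Finset.sum_div]
    refine Finset.sum_congr rfl fun l _ => ?_
    rw [← Complex.normSq_eq_norm_sq, Complex.normSq_apply]
    simp only [Matrix.map_apply, Matrix.neg_apply]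
    ring

/-! ### Multiplicities as intervals of indices. -/

theorem val_lt_card_filter_iff {n : ℕ} (p : Fin n → Prop) [DecidablePred p]
    (hp : ∀ i j, i ≤ j → p j → p i) (j : Fin n) :
    j.val < (Finset.univ.filter p).card ↔ p j := by
  constructor
  · intro h
    by_contra hj
    have hsub : Finset.univ.filter p ⊆ Finset.Iio j := by
      intro a ha
      rw [Finset.mem_Iio]
      by_contra hja
      exact hj (hp _ _ (not_lt.1 hja) (Finset.mem_filter.1 ha).2)
    have := Finset.card_le_card hsub
    rw [Fin.card_Iio] at this
    omega
  · intro h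
    have hsub : Finset.Iic j ⊆ Finset.univ.filter p := by
      intro a ha
      exact Finset.mem_filter.2 ⟨Finset.mem_univ a, hp _ _ (Finset.mem_Iic.1 ha) h⟩
    have := Finset.card_le_card hsub
    rw [Fin.card_Iic] at this
    omega

/-- `s` and `s + r` delimit the indices `j` with `d j = c`. -/
structure IsLevelRange {n : ℕ} (d : Fin n → ℝ) (c : ℝ) (s r : ℕ) : Prop where
  lt_iff : ∀ j : Fin n, j.val < s ↔ d j < c
  lt_add_iff : ∀ j : Fin n, j.val < s + r ↔ d j ≤ c
  add_le : s + r ≤ n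

/-- Monotonicity makes `{d < dₘ}` and `{d ≤ dₘ}` initial segments, of lengths `m - iₘ` and `m - iₘ +
rₘ`. The bound `iₘ ≤ m` is recorded because the subtraction is truncated. -/
theorem isLevelRange_mult {n m : ℕ} (hm : 1 ≤ m) (hmn : m ≤ n) {d : Fin n → ℝ} (hd : Monotone d) :
    lowerMult d ⟨m - 1, by omega⟩ ≤ m ∧
    IsLevelRange d (d ⟨m - 1, by omega⟩) (m - lowerMult d ⟨m - 1, by omega⟩)
      (mult d ⟨m - 1, by omega⟩) := by
  classical
  obtain ⟨k, hk⟩ : ∃ k : Fin n, k = ⟨m - 1, by omega⟩ := ⟨_, rfl⟩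
  rw [← hk]
  have hkv : k.val = m - 1 := by rw [hk]
  have h1 : (Finset.univ.filter fun j => d j < d k).card + lowerMult d k = m := by
    have hdis : Disjoint (Finset.univ.filter fun j => d j < d k)
        (Finset.univ.filter fun j : Fin n => j ≤ k ∧ d j = d k) := by
      rw [Finset.disjoint_filter]
      rintro j - h ⟨-, h'⟩
      exact h.ne h'
    have hun : (Finset.univ.filter fun j => d j < d k) ∪
        (Finset.univ.filter fun j : Fin n => j ≤ k ∧ d j = d k) = Finset.Iic k := by
      ext j
      simp only [Finset.mem_union, Finset.mem_filter, Finset.mem_univ, true_and, Finset.mem_Iic]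
      constructor
      · rintro (h | h)
        · by_contra hjk
          exact absurd (hd (not_le.1 hjk).le) (not_le.2 h)
        · exact h.1
      · intro h
        rcases (hd h).lt_or_eq with h' | h'
        · exact Or.inl h'
        · exact Or.inr ⟨h, h'⟩
    have := Finset.card_union_of_disjoint hdis
    rw [hun, Fin.card_Iic] at this
    have hl : lowerMult d k = (Finset.univ.filter fun j : Fin n => j ≤ k ∧ d j = d k).card := by
      rw [lowerMult]
    rw [hl]
    omega
  have h2 : (Finset.univ.filter fun j => d j < d k).card + mult d k =
      (Finset.univ.filter fun j => d j ≤ d k).card := by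
    have hdis : Disjoint (Finset.univ.filter fun j => d j < d k)
        (Finset.univ.filter fun j : Fin n => d j = d k) := by
      rw [Finset.disjoint_filter]
      rintro j - h h'
      exact h.ne h'
    have hl : mult d k = (Finset.univ.filter fun j : Fin n => d j = d k).card := by
      rw [mult]
    rw [hl, ← Finset.card_union_of_disjoint hdis, ← Finset.filter_or]
    simp only [le_iff_lt_or_eq]
  have h3 : m - lowerMult d k = (Finset.univ.filter fun j => d j < d k).card := by omega
  refine ⟨by omega, ?_, ?_, ?_⟩
  · intro j
    rw [h3]
    exact val_lt_card_filter_iff (fun j => d j < d k) (fun i j hij h => (hd hij).trans_lt h) j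
  · intro j
    rw [h3, h2]
    exact val_lt_card_filter_iff (fun j => d j ≤ d k) (fun i j hij h => (hd hij).trans h) j
  · rw [h3, h2]
    exact (Finset.card_le_univ _).trans_eq (Fintype.card_fin n)

theorem trace_realify_doubleDiag {n m : ℕ} (hm : 1 ≤ m) (hmn : m ≤ n) {d : Fin n → ℝ}
    {W : Matrix (Fin n) (Fin m) ℂ} (hW : Wᴴ * W = 1)
    (hk : ∀ k, d k ≠ d ⟨m - 1, by omega⟩ → ∑ l, ‖W k l‖ ^ 2 = if k.val < m then 1 else 0) :
    ((realify W)ᵀ * doubleDiag d * realify W).trace = 2 * ∑ k : Fin n with k.val < m, d k := by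
  set c := d ⟨m - 1, by omega⟩
  have hrow : ∀ k, (realify W * (realify W)ᵀ) (Sum.inl k) (Sum.inl k) = ∑ l, ‖W k l‖ ^ 2 ∧
      (realify W * (realify W)ᵀ) (Sum.inr k) (Sum.inr k) = ∑ l, ‖W k l‖ ^ 2 := by
    intro k
    simp only [Matrix.mul_apply, Fintype.sum_sum_type, realify, Matrix.transpose_apply,
      Matrix.fromBlocks_apply₁₁, Matrix.fromBlocks_apply₁₂, Matrix.fromBlocks_apply₂₁,
      Matrix.fromBlocks_apply₂₂, ← Finset.sum_add_distrib, Matrix.map_apply, Matrix.neg_apply,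
      ← Complex.normSq_eq_norm_sq, Complex.normSq_apply, neg_mul_neg, true_and]
    exact Finset.sum_congr rfl fun l _ => add_comm _ _
  have hp : ∑ k, ∑ l, ‖W k l‖ ^ 2 = m := by
    have h1 : (Wᴴ * W).trace = ((∑ k, ∑ l, ‖W k l‖ ^ 2 : ℝ) : ℂ) := by
      rw [Finset.sum_comm]
      simp only [Matrix.trace, Matrix.diag, Matrix.mul_apply, Matrix.conjTranspose_apply]
      push_cast
      refine Finset.sum_congr rfl fun l _ => Finset.sum_congr rfl fun k _ => ?_
      rw [← Complex.conj_mul']; rfl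
    rw [hW, Matrix.trace_one, Fintype.card_fin] at h1
    exact_mod_cast h1.symm
  have hcard : ∑ k : Fin n, (if k.val < m then (1 : ℝ) else 0) = m := by
    rw [Finset.sum_boole]
    norm_cast
    simp [Fin.card_filter_val_lt, hmn]
  rw [doubleDiag, trace_transpose_mul_diagonal_mul, Fintype.sum_sum_type]
  simp only [hrow, Sum.elim_inl, Sum.elim_inr]
  rw [← two_mul]
  congr 1
  have hterm : ∀ k, d k * ∑ l, ‖W k l‖ ^ 2 =
      (if k.val < m then d k else 0) + c * (∑ l, ‖W k l‖ ^ 2 - if k.val < m then 1 else 0) := by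
    intro k
    by_cases h : d k = c
    · rw [h]; split_ifs <;> ring
    · rw [hk k h]; split_ifs <;> ring
  rw [Finset.sum_congr rfl fun k _ => hterm k, Finset.sum_add_distrib, ← Finset.mul_sum,
    Finset.sum_sub_distrib, hp, hcard, Finset.sum_filter]
  ring

/-! ### The blocks of `Delta` as complex isometries with prescribed row norms. -/

/-- The complex matrix `P + √-1 Q` built from the blocks of `Delta`. -/
def complexBlocks (n m r i : ℕ) (U V : Matrix (Fin r) (Fin i) ℝ) : Matrix (Fin n) (Fin m) ℂ :=
  Matrix.of fun k l => ⟨columnBlocks n m r i 1 U k l, columnBlocks n m r i 0 V k l⟩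

theorem realify_complexBlocks (n m r i : ℕ) (U V : Matrix (Fin r) (Fin i) ℝ) :
    realify (complexBlocks n m r i U V) =
      Matrix.fromBlocks (columnBlocks n m r i 1 U) (columnBlocks n m r i 0 V)
      (-columnBlocks n m r i 0 V) (columnBlocks n m r i 1 U) := rfl

theorem complexBlocks_apply_of_lt {n m r i : ℕ} {U V : Matrix (Fin r) (Fin i) ℝ} {k : Fin n}
    {l : Fin m} (h : k.val < m - i ∨ l.val < m - i) :
    complexBlocks n m r i U V k l = if k.val = l.val then 1 else 0 := by
  simp only [complexBlocks, columnBlocks, Matrix.of_apply]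
  by_cases h1 : k.val < m - i ∧ l.val < m - i
  · simp only [h1, and_self, dif_pos, Matrix.one_apply, Fin.mk.injEq, Matrix.zero_apply]
    split_ifs <;> rfl
  · have h2 : ¬((m - i ≤ k.val ∧ k.val < m - i + r) ∧ m - i ≤ l.val) := by omega
    have h3 : k.val ≠ l.val := by omega
    rw [dif_neg h1, dif_neg h1, dif_neg h2, dif_neg h2, if_neg h3]
    rfl

theorem complexBlocks_apply_of_le {n m r i : ℕ} {U V : Matrix (Fin r) (Fin i) ℝ} {k : Fin n}
    {l : Fin m} (h : m - i + r ≤ k.val) (h' : m - i ≤ l.val) :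
    complexBlocks n m r i U V k l = 0 := by
  simp only [complexBlocks, columnBlocks, Matrix.of_apply]
  have h1 : ¬(k.val < m - i ∧ l.val < m - i) := by omega
  have h2 : ¬((m - i ≤ k.val ∧ k.val < m - i + r) ∧ m - i ≤ l.val) := by omega
  rw [dif_neg h1, dif_neg h1, dif_neg h2, dif_neg h2]
  rfl

theorem complexBlocks_apply_add {n m r i : ℕ} {U V : Matrix (Fin r) (Fin i) ℝ} {k : Fin n}
    {l : Fin m} {a : Fin r} {b : Fin i} (h : k.val = m - i + a.val) (h' : l.val = m - i + b.val) :
    complexBlocks n m r i U V k l = (U a b : ℂ) + Complex.I * (V a b : ℂ) := by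
  simp only [complexBlocks, columnBlocks, Matrix.of_apply]
  have h1 : ¬(k.val < m - i ∧ l.val < m - i) := by omega
  have h2 : ((m - i ≤ k.val ∧ k.val < m - i + r) ∧ m - i ≤ l.val) := by omega
  have ha : (⟨k.val - (m - i), by omega⟩ : Fin r) = a := Fin.ext (by simp; omega)
  have hb : (⟨l.val - (m - i), by omega⟩ : Fin i) = b := Fin.ext (by simp; omega)
  rw [dif_neg h1, dif_neg h1, dif_pos h2, dif_pos h2, ha, hb]
  apply Complex.ext <;> simp

theorem orthonormalColumns_iff {r i : ℕ} {U V : Matrix (Fin r) (Fin i) ℝ} :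
    OrthonormalColumns U V ↔ ∀ b b', ∑ a, star ((U a b : ℂ) + Complex.I * (V a b : ℂ)) *
      ((U a b' : ℂ) + Complex.I * (V a b' : ℂ)) = if b = b' then 1 else 0 := by
  rw [OrthonormalColumns, orthonormal_iff_ite]
  refine forall_congr' fun b => forall_congr' fun b' => ?_
  rw [PiLp.inner_apply]
  simp only [RCLike.inner_apply', Complex.star_def]

theorem conjTranspose_mul_complexBlocks {n m r i : ℕ} (hi : i ≤ m) (hr : m - i + r ≤ n)
    {U V : Matrix (Fin r) (Fin i) ℝ} (h : OrthonormalColumns U V) :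
    (complexBlocks n m r i U V)ᴴ * complexBlocks n m r i U V = 1 := by
  have hmn : m - i ≤ n := by omega
  ext l l'
  rw [Matrix.mul_apply, Matrix.one_apply]
  simp only [Matrix.conjTranspose_apply]
  by_cases hl : l.val < m - i
  · rw [Finset.sum_eq_single ⟨l.val, by omega⟩]
    · have hk : (⟨l.val, by omega⟩ : Fin n).val < m - i := hl
      rw [complexBlocks_apply_of_lt (Or.inl hk), complexBlocks_apply_of_lt (Or.inl hk)]
      simp [Fin.ext_iff]
    · intro k _ hk
      rw [complexBlocks_apply_of_lt (Or.inr hl), if_neg (fun h => hk (Fin.ext h))]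
      simp
    · simp
  by_cases hl' : l'.val < m - i
  · rw [Finset.sum_eq_single ⟨l'.val, by omega⟩]
    · have hk : (⟨l'.val, by omega⟩ : Fin n).val < m - i := hl'
      rw [complexBlocks_apply_of_lt (Or.inl hk), complexBlocks_apply_of_lt (Or.inl hk)]
      have : l'.val ≠ l.val := by omega
      simp [Fin.ext_iff, this, this.symm]
    · intro k _ hk
      rw [complexBlocks_apply_of_lt (l := l') (Or.inr hl'), if_neg (fun h => hk (Fin.ext h))]
      simp
    · simp
  rw [orthonormalColumns_iff] at h
  have hb := h ⟨l.val - (m - i), by omega⟩ ⟨l'.val - (m - i), by omega⟩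
  have hll : (l = l') ↔ (l.val - (m - i) = l'.val - (m - i)) := by rw [Fin.ext_iff]; omega
  simp only [Fin.mk.injEq, ← hll] at hb
  rw [← hb]
  symm
  -- For two columns beyond the identity block, only the rows `m - i ≤ k < m - i + r` contribute.
  refine Fintype.sum_of_injective (fun a : Fin r => (⟨m - i + a.val, by omega⟩ : Fin n))
    (fun a a' haa => Fin.ext (by simpa using haa)) _ _ (fun k hk => ?_) (fun a => ?_)
  · by_cases hk1 : k.val < m - i
    · rw [complexBlocks_apply_of_lt (Or.inl hk1), if_neg (by omega)]
      simp
    · rw [complexBlocks_apply_of_le (l := l) _ (by omega)]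
      · simp
      · by_contra hk2
        exact hk ⟨⟨k.val - (m - i), by omega⟩, Fin.ext (by simp; omega)⟩
  · rw [complexBlocks_apply_add (a := a) (b := ⟨l.val - (m - i), by omega⟩) rfl (by simp; omega),
      complexBlocks_apply_add (a := a) (b := ⟨l'.val - (m - i), by omega⟩) rfl (by simp; omega)]

theorem sum_norm_sq_complexBlocks {n m r i : ℕ} {U V : Matrix (Fin r) (Fin i) ℝ}
    (hm : m ≤ m - i + r) (k : Fin n) (hk : k.val < m - i ∨ m - i + r ≤ k.val) :
    ∑ l, ‖complexBlocks n m r i U V k l‖ ^ 2 = if k.val < m then 1 else 0 := by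
  rcases hk with hk | hk
  · rw [if_pos (by omega), Finset.sum_eq_single ⟨k.val, by omega⟩]
    · rw [complexBlocks_apply_of_lt (Or.inl hk)]; simp
    · intro l _ hl
      rw [complexBlocks_apply_of_lt (Or.inl hk), if_neg (fun h => hl (Fin.ext h.symm))]
      simp
    · simp
  · rw [if_neg (by omega)]
    refine Finset.sum_eq_zero fun l _ => ?_
    by_cases hl : l.val < m - i
    · rw [complexBlocks_apply_of_lt (Or.inr hl), if_neg (by omega)]; simp
    · rw [complexBlocks_apply_of_le hk (by omega)]; simp

/-- An isometry whose row norms are `1` on the first `s` rows is, up to a unitary change of the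
domain, the identity on the first `s` rows and columns. -/
theorem exists_unitary_normalize {n m s : ℕ} (hsm : s ≤ m) (hsn : s ≤ n)
    {W : Matrix (Fin n) (Fin m) ℂ} (hW : Wᴴ * W = 1)
    (hrow : ∀ k : Fin n, k.val < s → ∑ l, ‖W k l‖ ^ 2 = 1) :
    ∃ T : Matrix (Fin m) (Fin m) ℂ, Tᴴ * T = 1 ∧
      ∀ k l, (k.val < s ∨ l.val < s) → (W * T) k l = if k.val = l.val then 1 else 0 := by
  -- `WWᴴ` is an orthogonal projection, so the squared norm of its row `k` equals its diagonal
  -- entry; when that entry is `1`, the row is a standard basis vector (`hPk`).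
  have hP : (W * Wᴴ) * (W * Wᴴ)ᴴ = W * Wᴴ := by
    rw [Matrix.conjTranspose_mul, Matrix.conjTranspose_conjTranspose, Matrix.mul_assoc,
      ← Matrix.mul_assoc Wᴴ, hW, Matrix.one_mul]
  have hdiag : ∀ (k : Fin n) {q : ℕ} (X : Matrix (Fin n) (Fin q) ℂ),
      (X * Xᴴ) k k = ((∑ l, ‖X k l‖ ^ 2 : ℝ) : ℂ) := by
    intro k q X
    rw [Matrix.mul_apply]
    push_cast
    refine Finset.sum_congr rfl fun l _ => ?_
    rw [← Complex.mul_conj']; rfl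
  have hPk : ∀ k k' : Fin n, k.val < s → (W * Wᴴ) k k' = if k.val = k'.val then 1 else 0 := by
    intro k k' hk
    have h1 : (W * Wᴴ) k k = 1 := by rw [hdiag, hrow k hk]; simp
    have h2 := hdiag k (W * Wᴴ)
    rw [hP, h1] at h2
    have h3 : ∑ l, ‖(W * Wᴴ) k l‖ ^ 2 = 1 := by exact_mod_cast h2.symm
    split_ifs with hkk
    · rw [← Fin.ext hkk, h1]
    · have hkk' : k ≠ k' := fun h => hkk (congrArg _ h)
      rw [← Finset.add_sum_erase _ _ (Finset.mem_univ k), h1] at h3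
      have h4 : ∑ l ∈ Finset.univ.erase k, ‖(W * Wᴴ) k l‖ ^ 2 = 0 := by
        simpa using h3
      rw [Finset.sum_eq_zero_iff_of_nonneg fun l _ => sq_nonneg _] at h4
      have := h4 k' (Finset.mem_erase.2 ⟨hkk'.symm, Finset.mem_univ _⟩)
      simpa using this
  -- The conjugated rows of `W` have Gram matrix `WWᴴ`, so the first `s` of them are orthonormal; a
  -- completion to an orthonormal basis gives the columns of `T`.
  let w : Fin n → EuclideanSpace ℂ (Fin m) := fun k => WithLp.toLp 2 fun l => star (W k l)
  let v : Fin m → EuclideanSpace ℂ (Fin m) := fun l =>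
    if h : l.val < s then w ⟨l.val, by omega⟩ else 0
  have hinner : ∀ k (y : EuclideanSpace ℂ (Fin m)), inner ℂ (w k) y = ∑ l, W k l * y l := by
    intro k y
    rw [PiLp.inner_apply]
    refine Finset.sum_congr rfl fun l _ => ?_
    simp [w]
    ring
  have hww : ∀ k k', inner ℂ (w k) (w k') = (W * Wᴴ) k k' := by
    intro k k'
    rw [hinner, Matrix.mul_apply]
    rfl
  have hv : Orthonormal ℂ ({l : Fin m | l.val < s}.domRestrict v) := by
    rw [orthonormal_iff_ite]
    rintro ⟨l, hl⟩ ⟨l', hl'⟩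
    simp only [Set.mem_ofPred_eq] at hl hl'
    simp only [Set.domRestrict_apply, v, dif_pos hl, dif_pos hl']
    rw [hww, hPk _ _ hl]
    simp [Fin.ext_iff]
  obtain ⟨b, hb⟩ := hv.exists_orthonormalBasis_extension_of_card_eq (by simp)
  have hb' : ∀ k : Fin n, ∀ l : Fin m, l.val < s → k.val = l.val → b l = w k := by
    intro k l hl hkl
    rw [hb l hl]
    simp only [v, dif_pos hl]
    congr 1
    exact Fin.ext hkl.symm
  refine ⟨Matrix.of fun l' l => b l l', ?_, ?_⟩
  · ext l l'
    have := (orthonormal_iff_ite.1 b.orthonormal) l l'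
    rw [PiLp.inner_apply] at this
    rw [Matrix.one_apply, ← this, Matrix.mul_apply]
    simp [mul_comm]
  · intro k l hkl
    have h1 : (W * Matrix.of fun l' l => b l l') k l = inner ℂ (w k) (b l) := by
      rw [hinner, Matrix.mul_apply]; rfl
    rw [h1]
    by_cases hl : l.val < s
    · rw [hb' ⟨l.val, by omega⟩ l hl rfl, hww]
      have h2 := hPk ⟨l.val, by omega⟩ k hl
      have h3 : (W * Wᴴ)ᴴ = W * Wᴴ := by
        rw [Matrix.conjTranspose_mul, Matrix.conjTranspose_conjTranspose]
      rw [← h3, Matrix.conjTranspose_apply, h2]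
      simp only [eq_comm]
      split_ifs <;> simp
    · have hk : k.val < s := by omega
      rw [← hb' k ⟨k.val, by omega⟩ hk rfl, (orthonormal_iff_ite.1 b.orthonormal)]
      simp [Fin.ext_iff]

/-- A unitary `T` brings `WT` to block form: identity on the first `m - i` indices, zero in the rows
from `m - i + r` on, and an isometric block between. Since `TTᴴ = 1`, the product with the transpose
is unchanged. -/
theorem exists_complexBlocks_of_row_norms {n m r i : ℕ} (hi : i ≤ m) (hr : m - i + r ≤ n)
    (hm : m ≤ m - i + r) {W : Matrix (Fin n) (Fin m) ℂ} (hW : Wᴴ * W = 1)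
    (hrow : ∀ k : Fin n, (k.val < m - i ∨ m - i + r ≤ k.val) →
      ∑ l, ‖W k l‖ ^ 2 = if k.val < m then 1 else 0) :
    ∃ U V : Matrix (Fin r) (Fin i) ℝ, OrthonormalColumns U V ∧
      realify W * (realify W)ᵀ =
        realify (complexBlocks n m r i U V) * (realify (complexBlocks n m r i U V))ᵀ := by
  obtain ⟨T, hT, hWT⟩ := exists_unitary_normalize (s := m - i) (by omega) (by omega) hW
    (fun k hk => by rw [hrow k (Or.inl hk), if_pos (by omega)])
  have hTT : T * Tᴴ = 1 := mul_eq_one_comm.1 hT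
  have hzero : ∀ k l, m - i + r ≤ k.val → (W * T) k l = 0 := by
    intro k l hk
    have h1 := hrow k (Or.inr hk)
    rw [if_neg (by omega), Finset.sum_eq_zero_iff_of_nonneg fun l _ => sq_nonneg _] at h1
    rw [Matrix.mul_apply]
    refine Finset.sum_eq_zero fun l _ => ?_
    have := h1 l (Finset.mem_univ l)
    rw [norm_eq_zero.1 (pow_eq_zero_iff two_ne_zero |>.1 this), zero_mul]
  let Z : Matrix (Fin r) (Fin i) ℂ := Matrix.of fun a b =>
    (W * T) ⟨m - i + a.val, by omega⟩ ⟨m - i + b.val, by omega⟩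
  have hZ : ∀ a b, ((Z a b).re : ℂ) + Complex.I * ((Z a b).im : ℂ) = Z a b := fun a b => by
    rw [mul_comm]; exact Complex.re_add_im _
  have hC : complexBlocks n m r i (Z.map Complex.re) (Z.map Complex.im) = W * T := by
    ext k l
    by_cases hkl : k.val < m - i ∨ l.val < m - i
    · rw [complexBlocks_apply_of_lt hkl, hWT k l hkl]
    · by_cases hk : m - i + r ≤ k.val
      · rw [complexBlocks_apply_of_le hk (by omega), hzero k l hk]
      · rw [complexBlocks_apply_add (a := ⟨k.val - (m - i), by omega⟩)
          (b := ⟨l.val - (m - i), by omega⟩)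
          (by change k.val = m - i + (k.val - (m - i)); omega)
          (by change l.val = m - i + (l.val - (m - i)); omega)]
        simp only [Matrix.map_apply, hZ]
        have h1 : (⟨m - i + (k.val - (m - i)), by omega⟩ : Fin n) = k :=
          Fin.ext (by change m - i + (k.val - (m - i)) = k.val; omega)
        have h2 : (⟨m - i + (l.val - (m - i)), by omega⟩ : Fin m) = l :=
          Fin.ext (by change m - i + (l.val - (m - i)) = l.val; omega)
        simp only [Z, Matrix.of_apply, h1, h2]
  have hWTo : (W * T)ᴴ * (W * T) = 1 := by
    rw [Matrix.conjTranspose_mul, Matrix.mul_assoc, ← Matrix.mul_assoc Wᴴ, hW, Matrix.one_mul, hT]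
  refine ⟨Z.map Complex.re, Z.map Complex.im, ?_, ?_⟩
  · rw [orthonormalColumns_iff]
    intro b b'
    simp only [Matrix.map_apply, hZ]
    have h1 := congrFun (congrFun hWTo ⟨m - i + b.val, by omega⟩) ⟨m - i + b'.val, by omega⟩
    rw [Matrix.mul_apply, Matrix.one_apply] at h1
    simp only [Matrix.conjTranspose_apply, Fin.mk.injEq, Nat.add_left_cancel_iff,
      ← Fin.ext_iff] at h1
    rw [← h1]
    refine Fintype.sum_of_injective (fun a : Fin r => (⟨m - i + a.val, by omega⟩ : Fin n))
      (fun a a' haa => Fin.ext (by simpa using haa)) _ _ (fun k hk => ?_) (fun a => rfl)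
    by_cases hk1 : k.val < m - i
    · rw [hWT _ _ (Or.inl hk1), if_neg (fun h => by
        change k.val = m - i + b.val at h; omega)]
      simp
    · rw [hzero]
      · simp
      · by_contra hk2
        exact hk ⟨⟨k.val - (m - i), by omega⟩, Fin.ext (by simp; omega)⟩
  · rw [hC, ← realify_conjTranspose, ← realify_conjTranspose, ← realify_mul, ← realify_mul,
      Matrix.conjTranspose_mul, Matrix.mul_assoc W T, ← Matrix.mul_assoc T, hTT, Matrix.one_mul]

/-! ### The symplectic trace minimum principle and its minimizers. -/

theorem exists_symplectic_mul_eq_one {n : ℕ} {M : Matrix (Fin n ⊕ Fin n) (Fin n ⊕ Fin n) ℝ}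
    (hM : M ∈ Matrix.symplecticGroup (Fin n) ℝ) :
    ∃ N ∈ Matrix.symplecticGroup (Fin n) ℝ, M * N = 1 := by
  let M' : Matrix.symplecticGroup (Fin n) ℝ := ⟨M, hM⟩
  exact ⟨(M'⁻¹ : Matrix.symplecticGroup (Fin n) ℝ), SetLike.coe_mem _,
    congrArg Subtype.val (mul_inv_cancel M')⟩

theorem IsWilliamsonForm.trace_mul {n m : ℕ} {A M : Matrix (Fin n ⊕ Fin n) (Fin n ⊕ Fin n) ℝ}
    {d : Fin n → ℝ} (h : IsWilliamsonForm A d M) (S : Matrix (Fin n ⊕ Fin n) (Fin m ⊕ Fin m) ℝ) :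
    ((M * S)ᵀ * A * (M * S)).trace = (Sᵀ * doubleDiag d * S).trace := by
  have : (M * S)ᵀ * A * (M * S) = Sᵀ * (Mᵀ * A * M) * S := by
    simp only [Matrix.transpose_mul, Matrix.mul_assoc]
  rw [this, h.eq, fromBlocks_eq_doubleDiag]

theorem IsWilliamsonForm.exists_frame_eq {n m : ℕ}
    {A M : Matrix (Fin n ⊕ Fin n) (Fin n ⊕ Fin n) ℝ}
    {d : Fin n → ℝ} (h : IsWilliamsonForm A d M) {S : Matrix (Fin n ⊕ Fin n) (Fin m ⊕ Fin m) ℝ}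
    (hS : IsSymplecticFrame S) :
    ∃ S' : Matrix (Fin n ⊕ Fin n) (Fin m ⊕ Fin m) ℝ, IsSymplecticFrame S' ∧ S = M * S' := by
  obtain ⟨N, hN, hMN⟩ := exists_symplectic_mul_eq_one h.symplectic
  exact ⟨N * S, hS.mul_left hN, by rw [← Matrix.mul_assoc, hMN, Matrix.one_mul]⟩

/-- The sum of the `m` smallest symplectic eigenvalues is a lower bound in the symplectic trace
minimum principle. -/
theorem IsWilliamsonForm.le_trace {n m : ℕ} (hm : 1 ≤ m) (hmn : m ≤ n)
    {A M : Matrix (Fin n ⊕ Fin n) (Fin n ⊕ Fin n) ℝ}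
    {d : Fin n → ℝ} (h : IsWilliamsonForm A d M) {S : Matrix (Fin n ⊕ Fin n) (Fin m ⊕ Fin m) ℝ}
    (hS : IsSymplecticFrame S) : 2 * ∑ k : Fin n with k.val < m, d k ≤ (Sᵀ * A * S).trace := by
  obtain ⟨S', hS', rfl⟩ := h.exists_frame_eq hS
  rw [h.trace_mul]
  exact (hS'.le_trace_doubleDiag hm hmn h.pos h.mono).1

theorem IsLevelRange.ne_iff {n : ℕ} {d : Fin n → ℝ} {c : ℝ} {s r : ℕ} (h : IsLevelRange d c s r)
    (k : Fin n) : d k ≠ c ↔ k.val < s ∨ s + r ≤ k.val := by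
  rw [h.lt_iff, ← not_lt, h.lt_add_iff, not_le]
  exact ne_iff_lt_or_gt

theorem IsLevelRange.le_add {n m : ℕ} (hm : 1 ≤ m) (hmn : m ≤ n) {d : Fin n → ℝ} {s r : ℕ}
    (h : IsLevelRange d (d ⟨m - 1, by omega⟩) s r) : m ≤ s + r := by
  have : m - 1 < s + r := (h.lt_add_iff ⟨m - 1, by omega⟩).2 le_rfl
  omega

theorem mul_mem_Delta_of_trace_eq {n m : ℕ} (hm : 1 ≤ m) (hmn : m ≤ n)
    {A M : Matrix (Fin n ⊕ Fin n) (Fin n ⊕ Fin n) ℝ} (h : IsWilliamsonForm A (sympEig A) M)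
    {S : Matrix (Fin n ⊕ Fin n) (Fin m ⊕ Fin m) ℝ} (hS : IsSymplecticFrame S)
    (he : (Sᵀ * A * S).trace = 2 * ∑ k : Fin n with k.val < m, sympEig A k) :
    ∃ H ∈ Delta m hm hmn A, S * Sᵀ = M * H * Hᵀ * Mᵀ := by
  obtain ⟨S', hS', rfl⟩ := h.exists_frame_eq hS
  rw [h.trace_mul] at he
  obtain ⟨W, rfl, hW, hrow⟩ := (hS'.le_trace_doubleDiag hm hmn h.pos h.mono).2 he
  obtain ⟨hi, hL⟩ := isLevelRange_mult hm hmn h.mono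
  obtain ⟨U, V, hUV, hWUV⟩ := exists_complexBlocks_of_row_norms hi hL.add_le (hL.le_add hm hmn) hW
    (fun k hk => hrow k ((hL.ne_iff k).2 hk))
  refine ⟨_, ⟨U, V, hUV, rfl⟩, ?_⟩
  rw [← realify_complexBlocks, Matrix.transpose_mul, Matrix.mul_assoc M, ← Matrix.mul_assoc _ _ Mᵀ,
    hWUV]
  simp only [Matrix.mul_assoc]

theorem trace_eq_of_mem_Delta {n m : ℕ} (hm : 1 ≤ m) (hmn : m ≤ n)
    {A M : Matrix (Fin n ⊕ Fin n) (Fin n ⊕ Fin n) ℝ} (h : IsWilliamsonForm A (sympEig A) M)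
    {H : Matrix (Fin n ⊕ Fin n) (Fin m ⊕ Fin m) ℝ} (hH : H ∈ Delta m hm hmn A) :
    IsSymplecticFrame (M * H) ∧
      ((M * H)ᵀ * A * (M * H)).trace = 2 * ∑ k : Fin n with k.val < m, sympEig A k := by
  obtain ⟨U, V, hUV, rfl⟩ := hH
  obtain ⟨hi, hL⟩ := isLevelRange_mult hm hmn h.mono
  have hW := conjTranspose_mul_complexBlocks hi hL.add_le hUV
  rw [← realify_complexBlocks, h.trace_mul]
  refine ⟨(isSymplecticFrame_realify hW).mul_left h.symplectic,
    trace_realify_doubleDiag hm hmn hW fun k hk => ?_⟩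
  exact sum_norm_sq_complexBlocks (hL.le_add hm hmn) k ((hL.ne_iff k).1 hk)

/-- This is what makes the minimum attained. The witness `U = [I; 0]`, `V = 0` has orthonormal
columns because `iₘ ≤ rₘ`. -/
theorem Delta_nonempty {n m : ℕ} (hm : 1 ≤ m) (hmn : m ≤ n)
    (A : Matrix (Fin n ⊕ Fin n) (Fin n ⊕ Fin n) ℝ) : (Delta m hm hmn A).Nonempty := by
  classical
  have hir : lowerMult (sympEig A) ⟨m - 1, by omega⟩ ≤ mult (sympEig A) ⟨m - 1, by omega⟩ := by
    rw [lowerMult, mult]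
    exact Finset.card_le_card fun j hj => by
      simp only [Finset.mem_filter] at hj ⊢
      exact ⟨hj.1, hj.2.2⟩
  refine ⟨_, Matrix.of fun a b => if a.val = b.val then 1 else 0, 0, ?_, rfl⟩
  rw [orthonormalColumns_iff]
  intro b b'
  rw [Finset.sum_eq_single ⟨b.val, b.2.trans_le hir⟩]
  · by_cases h : b.val = b'.val <;> simp [Fin.ext_iff, h]
  · intro a _ ha
    have : a.val ≠ b.val := fun h => ha (Fin.ext h)
    simp [this]
  · simp

theorem exists_frame_trace_eq {n m : ℕ} (hm : 1 ≤ m) (hmn : m ≤ n)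
    {A : Matrix (Fin n ⊕ Fin n) (Fin n ⊕ Fin n) ℝ} (hA : A.PosDef) :
    ∃ S : Matrix (Fin n ⊕ Fin n) (Fin m ⊕ Fin m) ℝ, IsSymplecticFrame S ∧
      (Sᵀ * A * S).trace = 2 * ∑ k : Fin n with k.val < m, sympEig A k := by
  obtain ⟨M, hM⟩ := exists_isWilliamsonForm_sympEig hA
  obtain ⟨H, hH⟩ := Delta_nonempty hm hmn A
  exact ⟨M * H, trace_eq_of_mem_Delta hm hmn hM hH⟩

theorem le_trace_of_posDef {n m : ℕ} (hm : 1 ≤ m) (hmn : m ≤ n)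
    {A : Matrix (Fin n ⊕ Fin n) (Fin n ⊕ Fin n) ℝ} (hA : A.PosDef)
    {S : Matrix (Fin n ⊕ Fin n) (Fin m ⊕ Fin m) ℝ} (hS : IsSymplecticFrame S) :
    2 * ∑ k : Fin n with k.val < m, sympEig A k ≤ (Sᵀ * A * S).trace := by
  obtain ⟨M, hM⟩ := exists_isWilliamsonForm_sympEig hA
  exact hM.le_trace hm hmn hS

/-! ### Convexity of `sigma`. -/

theorem trace_conj_add_smul {ι κ : Type*} [Fintype ι] [Fintype κ] (S : Matrix ι κ ℝ)
    (A B : Matrix ι ι ℝ) (a b : ℝ) :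
    (Sᵀ * (a • A + b • B) * S).trace = a * (Sᵀ * A * S).trace + b * (Sᵀ * B * S).trace := by
  simp only [Matrix.mul_add, Matrix.add_mul, Matrix.mul_smul, Matrix.smul_mul, Matrix.trace_add,
    Matrix.trace_smul, smul_eq_mul]

theorem posDef_convexCombination {ι : Type*} [Fintype ι] {A B : Matrix ι ι ℝ} (hA : A.PosDef)
    (hB : B.PosDef) {a b : ℝ} (ha : 0 ≤ a) (hb : 0 ≤ b) (hab : a + b = 1) :
    (a • A + b • B).PosDef := by
  rcases ha.eq_or_lt with rfl | ha
  · simp only [zero_add] at hab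
    simpa [hab] using hB
  rcases hb.eq_or_lt with rfl | hb
  · simp only [add_zero] at hab
    simpa [hab] using hA
  exact (hA.smul ha).add (hB.smul hb)

theorem sigma_of_posDef {n : ℕ} (m : ℕ) {P : SymMat (Fin n ⊕ Fin n)}
    (hP : (P : Matrix (Fin n ⊕ Fin n) (Fin n ⊕ Fin n) ℝ).PosDef) :
    sigma m P = ((-2 * ∑ j : Fin n with j.val < m,
      sympEig (P : Matrix (Fin n ⊕ Fin n) (Fin n ⊕ Fin n) ℝ) j : ℝ) : EReal) := by
  rw [sigma, if_pos hP]

theorem sigma_of_not_posDef {n : ℕ} (m : ℕ) {P : SymMat (Fin n ⊕ Fin n)}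
    (hP : ¬(P : Matrix (Fin n ⊕ Fin n) (Fin n ⊕ Fin n) ℝ).PosDef) : sigma m P = ⊤ := by
  rw [sigma, if_neg hP]

theorem sigma_ne_bot {n : ℕ} (m : ℕ) (P : SymMat (Fin n ⊕ Fin n)) : sigma m P ≠ ⊥ := by
  by_cases hP : (P : Matrix (Fin n ⊕ Fin n) (Fin n ⊕ Fin n) ℝ).PosDef
  · rw [sigma_of_posDef m hP]; exact EReal.coe_ne_bot _
  · rw [sigma_of_not_posDef m hP]; simp

theorem EReal.coe_mul_ne_bot_of_nonneg {a : ℝ} (ha : 0 ≤ a) {x : EReal} (hx : x ≠ ⊥) :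
    (a : EReal) * x ≠ ⊥ := by
  rcases ha.eq_or_lt with rfl | ha
  · simp
  induction x with
  | bot => exact absurd rfl hx
  | top => rw [EReal.coe_mul_top_of_pos ha]; simp
  | coe x => rw [← EReal.coe_mul]; exact EReal.coe_ne_bot _

/-- A minimizer `S` for the convex combination is a competitor at both endpoints, and `tr(SᵀAS)` is
linear in `A`. -/
theorem isConvexExt_sigma {n m : ℕ} (hm : 1 ≤ m) (hmn : m ≤ n) :
    IsConvexExt (sigma (n := n) m) := by
  refine ⟨sigma_ne_bot m, fun x y a b ha hb hab => ?_⟩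
  -- Zero weights are treated apart since `0 * ⊤ = 0` in `EReal`; with positive weights an endpoint
  -- outside the cone makes the right side `⊤`.
  rcases ha.eq_or_lt with rfl | ha'
  · have : b = 1 := by linarith
    simp [this]
  rcases hb.eq_or_lt with rfl | hb'
  · have : a = 1 := by linarith
    simp [this]
  by_cases hx : (x : Matrix (Fin n ⊕ Fin n) (Fin n ⊕ Fin n) ℝ).PosDef
  swap
  · rw [sigma_of_not_posDef m hx, EReal.coe_mul_top_of_pos ha', EReal.top_add_of_ne_bot]
    · exact le_top
    · exact EReal.coe_mul_ne_bot_of_nonneg hb (sigma_ne_bot m y)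
  by_cases hy : (y : Matrix (Fin n ⊕ Fin n) (Fin n ⊕ Fin n) ℝ).PosDef
  swap
  · rw [sigma_of_not_posDef m hy, EReal.coe_mul_top_of_pos hb', EReal.add_top_of_ne_bot]
    · exact le_top
    · exact EReal.coe_mul_ne_bot_of_nonneg ha (sigma_ne_bot m x)
  have hxy : ((a • x + b • y : SymMat (Fin n ⊕ Fin n)) :
      Matrix (Fin n ⊕ Fin n) (Fin n ⊕ Fin n) ℝ).PosDef := posDef_convexCombination hx hy ha hb hab
  rw [sigma_of_posDef m hx, sigma_of_posDef m hy, sigma_of_posDef m hxy, ← EReal.coe_mul,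
    ← EReal.coe_mul, ← EReal.coe_add, EReal.coe_le_coe_iff]
  obtain ⟨S, hS, hSe⟩ := exists_frame_trace_eq hm hmn hxy
  have h1 := mul_le_mul_of_nonneg_left (le_trace_of_posDef hm hmn hx hS) ha
  have h2 := mul_le_mul_of_nonneg_left (le_trace_of_posDef hm hmn hy hS) hb
  have h3 := trace_conj_add_smul S (x : Matrix (Fin n ⊕ Fin n) (Fin n ⊕ Fin n) ℝ) y a b
  have h4 : (Sᵀ * ((a • x + b • y : SymMat (Fin n ⊕ Fin n)) :
      Matrix (Fin n ⊕ Fin n) (Fin n ⊕ Fin n) ℝ) * S).trace = _ := h3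
  rw [hSe] at h4
  linarith

/-! ### The subdifferential and directional perturbations of `A`. -/

/-- Where `sigma` is `⊤` the condition is void, so the subdifferential is an intersection of real
half-spaces; closedness and convexity follow from this form. -/
theorem mem_fenchelSubdifferential_sigma_iff {n m : ℕ} {A X : SymMat (Fin n ⊕ Fin n)}
    (hA : (A : Matrix (Fin n ⊕ Fin n) (Fin n ⊕ Fin n) ℝ).PosDef) :
    X ∈ fenchelSubdifferential (sigma m) A ↔ ∀ H : SymMat (Fin n ⊕ Fin n),
      (H : Matrix (Fin n ⊕ Fin n) (Fin n ⊕ Fin n) ℝ).PosDef → trInner X (H - A) ≤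
        2 * ∑ j : Fin n with j.val < m, sympEig (A : Matrix (Fin n ⊕ Fin n) (Fin n ⊕ Fin n) ℝ) j -
        2 * ∑ j : Fin n with j.val < m,
          sympEig (H : Matrix (Fin n ⊕ Fin n) (Fin n ⊕ Fin n) ℝ) j := by
  refine forall_congr' fun H => ?_
  by_cases hH : (H : Matrix (Fin n ⊕ Fin n) (Fin n ⊕ Fin n) ℝ).PosDef
  · rw [sigma_of_posDef m hA, sigma_of_posDef m hH, ← EReal.coe_sub, EReal.coe_le_coe_iff]
    simp only [hH, true_imp_iff]
    constructor <;> intro h <;> linarith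
  · rw [sigma_of_posDef m hA, sigma_of_not_posDef m hH, EReal.top_sub_coe]
    simp [hH]

theorem isClosed_fenchelSubdifferential_sigma {n m : ℕ} {A : SymMat (Fin n ⊕ Fin n)}
    (hA : (A : Matrix (Fin n ⊕ Fin n) (Fin n ⊕ Fin n) ℝ).PosDef) :
    IsClosed (fenchelSubdifferential (sigma m) A) := by
  have : fenchelSubdifferential (sigma m) A = {X | _} :=
    Set.ext fun X => mem_fenchelSubdifferential_sigma_iff hA
  rw [this]
  simp only [Set.ofPred_forall]
  refine isClosed_iInter fun H => isClosed_iInter fun _ => isClosed_le ?_ continuous_const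
  exact (continuous_subtype_val.matrix_mul continuous_const).matrix_trace

theorem convex_fenchelSubdifferential_sigma {n m : ℕ} {A : SymMat (Fin n ⊕ Fin n)}
    (hA : (A : Matrix (Fin n ⊕ Fin n) (Fin n ⊕ Fin n) ℝ).PosDef) :
    Convex ℝ (fenchelSubdifferential (sigma m) A) := by
  intro X hX Y hY a b ha hb hab
  rw [mem_fenchelSubdifferential_sigma_iff hA] at hX hY ⊢
  intro H hH
  have h1 : trInner (a • X + b • Y) (H - A) = a * trInner X (H - A) + b * trInner Y (H - A) := by
    simp [trInner, Matrix.add_mul, Matrix.trace_add]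
  rw [h1]
  have h2 := mul_le_mul_of_nonneg_left (hX H hH) ha
  have h3 := mul_le_mul_of_nonneg_left (hY H hH) hb
  have h4 := add_le_add h2 h3
  rwa [← add_mul, hab, one_mul] at h4

theorem trInner_neg_mul_transpose {ι κ : Type*} [Fintype ι] [Fintype κ] {X Y : SymMat ι}
    {S : Matrix ι κ ℝ} (hX : (X : Matrix ι ι ℝ) = -(S * Sᵀ)) :
    trInner X Y = -(Sᵀ * (Y : Matrix ι ι ℝ) * S).trace := by
  rw [trInner, hX, Matrix.neg_mul, Matrix.trace_neg, Matrix.mul_assoc, Matrix.trace_mul_comm]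

/-- With `b = ∑ |B i j|` the quadratic form of `B` is at least `-b|x|²`, so `ε = 1/(b + 1)` leaves
`ε|x|²` to spare. -/
theorem exists_posDef_one_add_smul {ι : Type*} [Fintype ι] [DecidableEq ι] {B : Matrix ι ι ℝ}
    (hB : Bᵀ = B) : ∃ ε : ℝ, 0 < ε ∧ (1 + ε • B).PosDef := by
  set b : ℝ := ∑ i, ∑ j, |B i j| with hb
  have hb0 : 0 ≤ b := Finset.sum_nonneg fun i _ => Finset.sum_nonneg fun j _ => abs_nonneg _
  have hq : ∀ x : ι → ℝ, -(b * (x ⬝ᵥ x)) ≤ x ⬝ᵥ (B *ᵥ x) := by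
    intro x
    have hx : ∀ i, x i * x i ≤ x ⬝ᵥ x := fun i =>
      Finset.single_le_sum (f := fun i => x i * x i) (fun j _ => mul_self_nonneg _)
        (Finset.mem_univ i)
    have h1 : x ⬝ᵥ (B *ᵥ x) = ∑ i, ∑ j, x i * (B i j * x j) := by
      simp only [dotProduct, Matrix.mulVec, Finset.mul_sum]
    rw [h1, hb, Finset.sum_mul, ← Finset.sum_neg_distrib]
    refine Finset.sum_le_sum fun i _ => ?_
    rw [Finset.sum_mul, ← Finset.sum_neg_distrib]
    refine Finset.sum_le_sum fun j _ => ?_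
    have h2 : |x i * x j| ≤ x ⬝ᵥ x := by
      rw [abs_le]
      constructor <;> nlinarith [hx i, hx j, sq_nonneg (x i - x j), sq_nonneg (x i + x j)]
    have h3 : |x i * (B i j * x j)| ≤ |B i j| * (x ⬝ᵥ x) := by
      rw [show x i * (B i j * x j) = B i j * (x i * x j) by ring, abs_mul]
      exact mul_le_mul_of_nonneg_left h2 (abs_nonneg _)
    exact (abs_le.1 h3).1
  refine ⟨(b + 1)⁻¹, by positivity, Matrix.PosDef.of_dotProduct_mulVec_pos ?_ fun x hx => ?_⟩
  · rw [Matrix.IsHermitian, Matrix.conjTranspose_eq_transpose_of_trivial]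
    simp [hB]
  · have hxx : 0 < x ⬝ᵥ x := by
      have := Matrix.dotProduct_star_self_pos_iff.2 hx
      simpa using this
    rw [star_trivial, Matrix.add_mulVec, Matrix.one_mulVec, Matrix.smul_mulVec, dotProduct_add,
      dotProduct_smul, smul_eq_mul]
    have h1 := mul_le_mul_of_nonneg_left (hq x) (by positivity : 0 ≤ (b + 1)⁻¹)
    have h2 : (b + 1)⁻¹ * (b * (x ⬝ᵥ x)) = x ⬝ᵥ x - (b + 1)⁻¹ * (x ⬝ᵥ x) := by
      field_simp; ring
    have h3 : 0 < (b + 1)⁻¹ * (x ⬝ᵥ x) := by positivity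
    linarith

theorem exists_posDef_add_smul {ι : Type*} [Fintype ι] [DecidableEq ι] {A B : Matrix ι ι ℝ}
    (hA : A.PosDef) (hB : Bᵀ = B) : ∃ ε : ℝ, 0 < ε ∧ (A + ε • B).PosDef := by
  obtain ⟨C, hC, rfl⟩ := exists_transpose_mul_self_of_posDef hA
  obtain ⟨ε, hε, h⟩ := exists_posDef_one_add_smul (B := (C⁻¹)ᵀ * B * C⁻¹)
    (by simp [Matrix.transpose_mul, hB, Matrix.mul_assoc])
  refine ⟨ε, hε, ?_⟩
  have h1 := h.conjTranspose_mul_mul_same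
    (Matrix.mulVec_injective_of_isUnit ((Matrix.isUnit_iff_isUnit_det C).2 hC))
  have h2 : Cᴴ * (1 + ε • ((C⁻¹)ᵀ * B * C⁻¹)) * C = Cᵀ * C + ε • B := by
    rw [Matrix.conjTranspose_eq_transpose_of_trivial, Matrix.mul_add, Matrix.add_mul,
      Matrix.mul_one, Matrix.mul_smul, Matrix.smul_mul]
    congr 2
    have : Cᵀ * ((C⁻¹)ᵀ * B * C⁻¹) * C = (C⁻¹ * C)ᵀ * B * (C⁻¹ * C) := by
      simp only [Matrix.transpose_mul, Matrix.mul_assoc]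
    rw [this, Matrix.nonsing_inv_mul _ hC]
    simp
  rwa [h2] at h1

theorem continuous_trace_conj {ι κ : Type*} [Fintype ι] [Fintype κ] (A : Matrix ι ι ℝ) :
    Continuous fun S : Matrix ι κ ℝ => (Sᵀ * A * S).trace :=
  ((continuous_id.matrix_transpose.matrix_mul continuous_const).matrix_mul
    continuous_id).matrix_trace

/-- For `A = CᵀC` the trace is the sum of the squared entries of `CS`, so the set lies in the image
under `C⁻¹` of a cube. -/
theorem isCompact_trace_conj_le {ι κ : Type*} [Fintype ι] [DecidableEq ι] [Fintype κ]
    {A : Matrix ι ι ℝ} (hA : A.PosDef) (R : ℝ) :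
    IsCompact {S : Matrix ι κ ℝ | (Sᵀ * A * S).trace ≤ R} := by
  have hcl : IsClosed {S : Matrix ι κ ℝ | (Sᵀ * A * S).trace ≤ R} :=
    isClosed_le (continuous_trace_conj A) continuous_const
  obtain ⟨C, hC, rfl⟩ := exists_transpose_mul_self_of_posDef hA
  have hK : IsCompact {N : Matrix ι κ ℝ | ∀ i j, N i j ∈ Set.Icc (-√R) √R} := by
    have h1 : IsCompact (Set.univ.pi fun _ : ι => Set.univ.pi fun _ : κ => Set.Icc (-√R) √R) :=
      isCompact_univ_pi fun _ => isCompact_univ_pi fun _ => isCompact_Icc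
    have h2 : {N : ι → κ → ℝ | ∀ i j, N i j ∈ Set.Icc (-√R) √R} =
        Set.univ.pi fun _ : ι => Set.univ.pi fun _ : κ => Set.Icc (-√R) √R := by
      ext N
      simp only [Set.mem_pi, Set.mem_univ, true_imp_iff, Set.mem_ofPred_eq]
    rw [← h2] at h1
    exact h1
  refine (hK.image (f := fun N => C⁻¹ * N)
    (continuous_const.matrix_mul continuous_id)).of_isClosed_subset hcl ?_
  intro S hS
  refine ⟨C * S, fun i j => ?_, ?_⟩
  · have h1 : (Sᵀ * (Cᵀ * C) * S).trace = ∑ i, ∑ j, (C * S) i j ^ 2 := by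
      have : Sᵀ * (Cᵀ * C) * S = (C * S)ᵀ * (C * S) := by
        simp only [Matrix.transpose_mul, Matrix.mul_assoc]
      rw [this, Finset.sum_comm, Matrix.trace]
      simp only [Matrix.diag, Matrix.mul_apply (M := (C * S)ᵀ), Matrix.transpose_apply, sq]
    have h2 : (C * S) i j ^ 2 ≤ R := by
      refine le_trans ?_ (h1.symm.trans_le hS)
      refine le_trans ?_ (Finset.single_le_sum (f := fun i => ∑ j, (C * S) i j ^ 2)
        (fun i _ => Finset.sum_nonneg fun j _ => sq_nonneg _) (Finset.mem_univ i))
      exact Finset.single_le_sum (f := fun j => (C * S) i j ^ 2) (fun j _ => sq_nonneg _)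
        (Finset.mem_univ j)
    exact abs_le.1 (Real.abs_le_sqrt h2)
  · change C⁻¹ * (C * S) = S
    rw [← Matrix.mul_assoc, Matrix.nonsing_inv_mul _ hC, Matrix.one_mul]

/-- Every linear functional is dominated on the subdifferential by its value at some
`-S Sᵀ`, where `S` is a minimizer in the symplectic trace minimum principle. -/
theorem exists_frame_trInner_le {n m : ℕ} (hm : 1 ≤ m) (hmn : m ≤ n)
    {A X : SymMat (Fin n ⊕ Fin n)} (hA : (A : Matrix (Fin n ⊕ Fin n) (Fin n ⊕ Fin n) ℝ).PosDef)
    (hX : X ∈ fenchelSubdifferential (sigma m) A) (B : SymMat (Fin n ⊕ Fin n)) :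
    ∃ S : Matrix (Fin n ⊕ Fin n) (Fin m ⊕ Fin m) ℝ, IsSymplecticFrame S ∧
      (Sᵀ * (A : Matrix (Fin n ⊕ Fin n) (Fin n ⊕ Fin n) ℝ) * S).trace =
        2 * ∑ k : Fin n with k.val < m,
          sympEig (A : Matrix (Fin n ⊕ Fin n) (Fin n ⊕ Fin n) ℝ) k ∧
      trInner X B ≤ -(Sᵀ * (B : Matrix (Fin n ⊕ Fin n) (Fin n ⊕ Fin n) ℝ) * S).trace := by
  rw [mem_fenchelSubdifferential_sigma_iff hA] at hX
  obtain ⟨A', hA'⟩ : ∃ A', A' = (A : Matrix (Fin n ⊕ Fin n) (Fin n ⊕ Fin n) ℝ) := ⟨_, rfl⟩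
  obtain ⟨B', hB'⟩ : ∃ B', B' = (B : Matrix (Fin n ⊕ Fin n) (Fin n ⊕ Fin n) ℝ) := ⟨_, rfl⟩
  obtain ⟨ε, hε, hεp⟩ := exists_posDef_add_smul hA B.2
  obtain ⟨S₀, hS₀, hS₀e⟩ := exists_frame_trace_eq hm hmn hA
  have hle : ∀ S : Matrix (Fin n ⊕ Fin n) (Fin m ⊕ Fin m) ℝ, IsSymplecticFrame S → _ :=
    fun S hS => le_trace_of_posDef hm hmn hA hS
  have hle' : ∀ S : Matrix (Fin n ⊕ Fin n) (Fin m ⊕ Fin m) ℝ, 0 ≤ (Sᵀ * (A' + ε • B') * S).trace :=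
    fun S => by
      rw [hA', hB']
      exact (hεp.posSemidef.conjTranspose_mul_mul_same S).trace_nonneg
  set a₀ := 2 * ∑ k : Fin n with k.val < m,
    sympEig (A : Matrix (Fin n ⊕ Fin n) (Fin n ⊕ Fin n) ℝ) k with ha₀
  have ha₀n : 0 ≤ a₀ := by
    rw [← hS₀e]
    exact (hA.posSemidef.conjTranspose_mul_mul_same S₀).trace_nonneg
  rw [← hA'] at hS₀e hle
  rw [← hA', ← hB']
  set b₀ := (S₀ᵀ * B' * S₀).trace with hb₀
  set β := trInner X B with hβ
  have hlin : ∀ (S : Matrix (Fin n ⊕ Fin n) (Fin m ⊕ Fin m) ℝ) (t : ℝ),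
      (Sᵀ * (A' + t • B') * S).trace = (Sᵀ * A' * S).trace + t * (Sᵀ * B' * S).trace := by
    intro S t
    have := trace_conj_add_smul S A' B' 1 t
    simpa using this
  -- `S` is a minimizer for `A + tB`. Comparison with `S₀`, together with `tr(Sᵀ(A + εB)S) ≥ 0` to
  -- bound `t tr(SᵀBS)` below by `-(t/ε) tr(SᵀAS)`, gives the first estimate. The subgradient
  -- inequality at `A + tB`, with `a₀ ≤ tr(SᵀAS)`, gives the second after division by `t`.
  have hopt : ∀ t, 0 < t → t ≤ ε → ∃ S : Matrix (Fin n ⊕ Fin n) (Fin m ⊕ Fin m) ℝ,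
      IsSymplecticFrame S ∧ (1 - t / ε) * (Sᵀ * A' * S).trace ≤ a₀ + t * b₀ ∧
        β ≤ -(Sᵀ * B' * S).trace := by
    intro t ht htε
    have htp : (A' + t • B').PosDef := by
      have h1 : A' + t • B' = (1 - t / ε) • A' + (t / ε) • (A' + ε • B') := by
        rw [smul_add, smul_smul, div_mul_cancel₀ _ hε.ne', ← add_assoc, ← add_smul]
        simp
      rw [h1]
      have h2 : t / ε ≤ 1 := (div_le_one hε).2 htε
      rw [hA', hB']
      exact posDef_convexCombination hA hεp (by linarith) (by positivity) (by ring)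
    obtain ⟨S, hS, hSe⟩ := exists_frame_trace_eq hm hmn htp
    have h1 := le_trace_of_posDef hm hmn htp hS₀
    rw [← hSe, hlin, hlin, hS₀e] at h1
    refine ⟨S, hS, ?_, ?_⟩
    · have h2 := hle' S
      rw [hlin] at h2
      have h3 := mul_nonneg (div_nonneg ht.le hε.le) h2
      have h4 : t / ε * (ε * (Sᵀ * B' * S).trace) = t * (Sᵀ * B' * S).trace := by
        field_simp
      rw [mul_add, h4] at h3
      linarith
    · have hc : ((A + t • B : SymMat (Fin n ⊕ Fin n)) :
          Matrix (Fin n ⊕ Fin n) (Fin n ⊕ Fin n) ℝ) = A' + t • B' := by rw [hA', hB']; rfl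
      have h2 := hX (A + t • B) (by rw [hc]; exact htp)
      rw [hc, ← hSe, hlin] at h2
      have h3 : trInner X (A + t • B - A) = t * β := by
        rw [add_sub_cancel_left, hβ]
        simp [trInner, Matrix.trace_smul]
      rw [h3] at h2
      have h4 := hle S hS
      have h5 : t * β ≤ t * -(Sᵀ * B' * S).trace := by linarith
      exact le_of_mul_le_mul_left h5 ht
  -- For `t ≤ ε/2` the factor `1 - t/ε` is at least `1/2`, whence the factor `2`.
  let R := 2 * (a₀ + ε * |b₀|)
  have hZc : IsCompact {S : Matrix (Fin n ⊕ Fin n) (Fin m ⊕ Fin m) ℝ |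
      (Sᵀ * A' * S).trace ≤ R ∧ IsSymplecticFrame S ∧ β ≤ -(Sᵀ * B' * S).trace} := by
    rw [Set.ofPred_and]
    refine (isCompact_trace_conj_le (by rw [hA']; exact hA) R).inter_right ?_
    rw [Set.ofPred_and]
    refine IsClosed.inter (isClosed_eq ?_ continuous_const) (isClosed_le continuous_const ?_)
    · exact (continuous_id.matrix_transpose.matrix_mul continuous_const).matrix_mul continuous_id
    · exact (continuous_trace_conj B').neg
  have hmem : ∀ t, 0 < t → t ≤ ε / 2 → ∃ S ∈ {S : Matrix (Fin n ⊕ Fin n) (Fin m ⊕ Fin m) ℝ |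
      (Sᵀ * A' * S).trace ≤ R ∧ IsSymplecticFrame S ∧ β ≤ -(Sᵀ * B' * S).trace},
      (1 - t / ε) * (Sᵀ * A' * S).trace ≤ a₀ + t * b₀ := by
    intro t ht htε
    obtain ⟨S, hS, h1, h2⟩ := hopt t ht (by linarith)
    refine ⟨S, ⟨?_, hS, h2⟩, h1⟩
    have h3 : t / ε ≤ 1 / 2 := by rw [div_le_iff₀ hε]; linarith
    have h4 := hle S hS
    have h5 : t * b₀ ≤ ε * |b₀| :=
      (mul_le_mul_of_nonneg_left (le_abs_self b₀) ht.le).trans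
        (mul_le_mul_of_nonneg_right (by linarith) (abs_nonneg _))
    have h6 : (1 / 2) * (Sᵀ * A' * S).trace ≤ (1 - t / ε) * (Sᵀ * A' * S).trace :=
      mul_le_mul_of_nonneg_right (by linarith) (by linarith)
    simp only [R]
    linarith
  -- Instead of a convergent sequence of the frames for `t → 0`, `tr(SᵀAS)` is minimized over the
  -- compact set containing them all; its minimum `f` inherits the first estimate for every small
  -- `t`, which forces `f ≤ a₀`.
  obtain ⟨S, ⟨-, hS, hSβ⟩, hmin⟩ := hZc.exists_isMinOn
    (by obtain ⟨S, hS, -⟩ := hmem (ε / 2) (by positivity) le_rfl; exact ⟨S, hS⟩)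
    (continuous_trace_conj A').continuousOn
  refine ⟨S, hS, le_antisymm ?_ (hle S hS), hSβ⟩
  set f := (Sᵀ * A' * S).trace with hf
  have hineq : ∀ t, 0 < t → t ≤ ε / 2 → (1 - t / ε) * f ≤ a₀ + t * b₀ := by
    intro t ht htε
    obtain ⟨S', hS', h⟩ := hmem t ht htε
    have h3 : t / ε ≤ 1 / 2 := by rw [div_le_iff₀ hε]; linarith
    exact (mul_le_mul_of_nonneg_left (hmin hS') (by linarith)).trans h
  by_contra hlt
  push Not at hlt
  set c := |f / ε + b₀| with hc
  have hc0 : 0 ≤ c := abs_nonneg _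
  -- `hineq` gives `f - a₀ ≤ t * c`, while this `t` keeps `t * c` below half the gap `f - a₀`.
  set t := min (ε / 2) ((f - a₀) / (2 * (c + 1))) with ht
  have hfa : 0 < f - a₀ := by linarith
  have ht0 : 0 < t := lt_min (by positivity) (by positivity)
  have h1 := hineq t ht0 (min_le_left _ _)
  have h2 : t * (2 * (c + 1)) ≤ f - a₀ := by
    rw [← le_div_iff₀ (by positivity)]; exact min_le_right _ _
  have h3 : t * (f / ε + b₀) ≤ t * c := mul_le_mul_of_nonneg_left (le_abs_self _) ht0.le
  have h4 : (1 - t / ε) * f = f - t * (f / ε) := by ring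
  have h5 : 0 ≤ t * c := mul_nonneg ht0.le hc0
  nlinarith

/-! ### Linear functionals on symmetric matrices and the separation argument. -/

instance {ι κ : Type*} : LocallyConvexSpace ℝ (Matrix ι κ ℝ) :=
  inferInstanceAs (LocallyConvexSpace ℝ (ι → κ → ℝ))

/-- The symmetric part of a matrix. -/
noncomputable def symPart {ι : Type*} : Matrix ι ι ℝ →ₗ[ℝ] SymMat ι where
  toFun N := ⟨(2⁻¹ : ℝ) • (N + Nᵀ), by
    change ((2⁻¹ : ℝ) • (N + Nᵀ))ᵀ = _
    simp [add_comm]⟩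
  map_add' N N' := by
    ext i j
    simp; ring
  map_smul' c N := by
    ext i j
    simp; ring

theorem symPart_coe {ι : Type*} (Y : SymMat ι) : symPart (Y : Matrix ι ι ℝ) = Y := by
  have hY : (Y : Matrix ι ι ℝ)ᵀ = Y := Y.2
  apply Subtype.ext
  change (2⁻¹ : ℝ) • ((Y : Matrix ι ι ℝ) + (Y : Matrix ι ι ℝ)ᵀ) = Y
  rw [hY]
  ext i j
  simp; ring

theorem symPart_transpose {ι : Type*} (N : Matrix ι ι ℝ) : symPart Nᵀ = symPart N := by
  apply Subtype.ext
  change (2⁻¹ : ℝ) • (Nᵀ + Nᵀᵀ) = (2⁻¹ : ℝ) • (N + Nᵀ)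
  rw [Matrix.transpose_transpose, add_comm]

/-- Every linear functional on symmetric matrices is `Y ↦ ⟨Y, B⟩` for some `B`. -/
theorem exists_trInner_eq {ι : Type*} [Fintype ι] [DecidableEq ι] (f : SymMat ι →ₗ[ℝ] ℝ) :
    ∃ B : SymMat ι, ∀ Y, f Y = trInner Y B := by
  -- Extending `f` through the symmetric part lets `B` be read off on matrix units, and makes `B`
  -- symmetric.
  let g : Matrix ι ι ℝ →ₗ[ℝ] ℝ := f ∘ₗ symPart
  let B : Matrix ι ι ℝ := Matrix.of fun i j => g (Matrix.single i j 1)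
  have hB : B.IsSymm := by
    ext i j
    simp only [B, g, Matrix.transpose_apply, Matrix.of_apply, LinearMap.comp_apply]
    rw [← symPart_transpose, Matrix.transpose_single]
  refine ⟨⟨B, hB⟩, fun Y => ?_⟩
  have h1 : f Y = g (Y : Matrix ι ι ℝ) := by
    simp only [g, LinearMap.comp_apply, symPart_coe]
  have h2 : ∀ i j, Matrix.single i j ((Y : Matrix ι ι ℝ) i j) =
      (Y : Matrix ι ι ℝ) i j • Matrix.single i j (1 : ℝ) := fun i j => by
    rw [Matrix.smul_single, smul_eq_mul, mul_one]
  rw [h1, Matrix.matrix_eq_sum_single (Y : Matrix ι ι ℝ), map_sum, trInner, Matrix.trace]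
  refine Finset.sum_congr rfl fun i _ => ?_
  rw [map_sum, Matrix.diag_apply, Matrix.mul_apply]
  refine Finset.sum_congr rfl fun j _ => ?_
  have h3 : B j i = B i j := hB.apply i j
  rw [h2, map_smul, smul_eq_mul]
  change _ = (Y : Matrix ι ι ℝ) i j * B j i
  rw [h3]
  rfl

end SympSub

theorem mainTheorem3 (n m : ℕ) (hm : 1 ≤ m) (hmn : m ≤ n) :
    SympSub.IsConvexExt (SympSub.sigma (n := n) m) ∧
    ∀ (A : SympSub.SymMat (Fin n ⊕ Fin n)) (M : Matrix (Fin n ⊕ Fin n) (Fin n ⊕ Fin n) ℝ),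
      (A : Matrix (Fin n ⊕ Fin n) (Fin n ⊕ Fin n) ℝ).PosDef →
      M ∈ SympSub.SpEigenbasis (A : Matrix (Fin n ⊕ Fin n) (Fin n ⊕ Fin n) ℝ) →
      SympSub.fenchelSubdifferential (SympSub.sigma m) A =
        closedConvexHull ℝ {X : SympSub.SymMat (Fin n ⊕ Fin n) |
          ∃ H ∈ SympSub.Delta m hm hmn (A : Matrix (Fin n ⊕ Fin n) (Fin n ⊕ Fin n) ℝ),
            (X : Matrix (Fin n ⊕ Fin n) (Fin n ⊕ Fin n) ℝ) = -(M * H * Hᵀ * Mᵀ)} := by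
  refine ⟨SympSub.isConvexExt_sigma hm hmn, fun A M hA hM => Set.Subset.antisymm ?_ ?_⟩
  · intro X hX
    by_contra hXn
    -- The functional is `Y ↦ ⟨Y, B⟩`, and the minimizer attached to `X` and `B` gives a point of
    -- the hull where it is at least `f X`.
    obtain ⟨f, u, hfu, hu⟩ :=
      geometric_hahn_banach_closed_point convex_closedConvexHull isClosed_closedConvexHull hXn
    obtain ⟨B, hB⟩ := SympSub.exists_trInner_eq f.toLinearMap
    obtain ⟨S, hS, hSA, hSB⟩ := SympSub.exists_frame_trInner_le hm hmn hA hX B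
    obtain ⟨H, hH, hHS⟩ := SympSub.mul_mem_Delta_of_trace_eq hm hmn hM hS hSA
    let Y : SympSub.SymMat (Fin n ⊕ Fin n) := ⟨-(S * Sᵀ), by
      change (-(S * Sᵀ))ᵀ = _
      simp [Matrix.transpose_mul]⟩
    have hY := hfu Y (subset_closedConvexHull ⟨H, hH, by rw [← hHS]⟩)
    have h1 : f Y = _ := (hB Y).trans (SympSub.trInner_neg_mul_transpose (S := S) rfl)
    have h2 : f X = _ := hB X
    linarith
  · refine closedConvexHull_min ?_ (SympSub.convex_fenchelSubdifferential_sigma hA)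
      (SympSub.isClosed_fenchelSubdifferential_sigma hA)
    rintro X ⟨H, hH, hX⟩
    rw [SympSub.mem_fenchelSubdifferential_sigma_iff hA]
    intro P hP
    -- `MH` is a symplectic frame that attains the minimum at `A` and is a competitor at `P`; the
    -- difference of the two relations is the subgradient inequality.
    obtain ⟨hF, hFe⟩ := SympSub.trace_eq_of_mem_Delta hm hmn hM hH
    have hX' : (X : Matrix (Fin n ⊕ Fin n) (Fin n ⊕ Fin n) ℝ) = -((M * H) * (M * H)ᵀ) := by
      rw [hX]; simp only [Matrix.transpose_mul, Matrix.mul_assoc]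
    rw [SympSub.trInner_neg_mul_transpose hX']
    have h1 := SympSub.le_trace_of_posDef hm hmn hP hF
    have h2 := SympSub.trace_conj_add_smul (M * H)
      (P : Matrix (Fin n ⊕ Fin n) (Fin n ⊕ Fin n) ℝ) A 1 (-1)
    rw [one_smul, neg_one_smul, ← sub_eq_add_neg, hFe] at h2
    rw [Submodule.coe_sub, h2]
    linarith
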